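/- Let $m\ge 0$, let $M,N\in\mathbb N\cup\{\infty\}$, let $(x_i)_{1\le i\le M}$ be pairwise distinct points and $(y_j)_{1\le j\le N}$ pairwise distinct points of $\mathbb R^m$ (indices are finite, so $i<\infty$ when $M=\infty$, and likewise for $j$), and let $$\mu^-=\sum_{i=1}^M m_i'\,\delta_{x_i},\qquad \mu^+=\sum_{j=1}^N m_j\,\delta_{y_j},\qquad m_i',m_j\ge 0,\qquad \sum_{i=1}^M m_i'=\sum_{j=1}^N m_j<\infty .$$ Let $T$ be a transport path from $\mu^-$ to $\mu^+$, i.e. a rectifiable $1$-current in $\mathbb R^m$ with $\partial T=\mu^+-\mu^-$. Let $\Gamma$ be the space of eventually constant $1$-Lipschitz curves $\gamma:[0,\infty)\to\mathbb R^m$, with the Borel $\sigma$-algebra of uniform convergence on compact sets. Such a curve is simple if it is injective on $[t_0(\gamma),t_\infty(\gamma)]$, where $[0,t_0(\gamma)]$ and $[t_\infty(\gamma),\infty)$ are its maximal initial and final intervals of constancy. For a simple curve $\gamma$ let $I_\gamma$ be the rectifiable $1$-current carried by $\mathrm{Im}(\gamma)$ with multiplicity $1$ and orientation $\gamma'/|\gamma'|$.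 Let $\Gamma_{x,y}$ be the set of $\gamma\in\Gamma$ with $\gamma(0)=x$ and $\lim_{t\to\infty}\gamma(t)=y$. A finite positive measure $\eta$ on $\Gamma$ is a *good decomposition* of $T$ if $T$ is normal ($\mathbf M(T)+\mathbf M(\partial T)<\infty$), $\eta$ is concentrated on non-constant simple curves, $T(\omega)=\int_\Gamma I_\gamma(\omega)\,d\eta(\gamma)$ for every smooth compactly supported $1$-form $\omega$, and $$\mathbf M(T)=\int_\Gamma \mathbf M(I_\gamma)\,d\eta=\int_\Gamma \mathcal H^1(\mathrm{Im}(\gamma))\,d\eta,\qquad \mathbf M(\partial T)=\int_\Gamma \mathbf M(\partial I_\gamma)\,d\eta=2\,\eta(\Gamma).$$ For such $\eta$ put $S_{i,j}(\eta)=\frac1{\eta(\Gamma_{x_i,y_j})}\int_{\Gamma_{x_i,y_j}}I_\gamma\,d\eta$ if $\eta(\Gamma_{x_i,y_j})>0$, and $S_{i,j}(\eta)=0$ otherwise. A good decomposition $\eta$ of $T$ is a *better decomposition* of $T$ if for all $1\le i_1<i_2\le M$ and $1\le j_1<j_2\le N$, $$S_{i_1,j_1}(\eta)-S_{i_1,j_2}(\eta)-S_{i_2,j_1}(\eta)+S_{i_2,j_2}(\eta)=0$$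 implies $$\eta(\Gamma_{x_{i_1},y_{j_1}})=\eta(\Gamma_{x_{i_1},y_{j_2}})=\eta(\Gamma_{x_{i_2},y_{j_1}})=\eta(\Gamma_{x_{i_2},y_{j_2}})=0 .$$ Write $\tilde\eta\preccurlyeq\eta$ if for each pair $(i,j)$ there is $a_{i,j}\ge 0$ with $\int_{\Gamma_{x_i,y_j}}I_\gamma\,d\tilde\eta=a_{i,j}\int_{\Gamma_{x_i,y_j}}I_\gamma\,d\eta$. **Theorem.** For every good decomposition $\eta$ of $T$ there exists a better decomposition $\eta_\infty$ of $T$ such that $\eta_\infty\preccurlyeq\eta$. -/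

import Mathlib

open MeasureTheory Set Filter Topology
open scoped NNReal ENNReal

noncomputable section

namespace TransportPath

/-- The Euclidean space `ℝ^m`. -/
abbrev E (m : ℕ) : Type := EuclideanSpace ℝ (Fin m)

/-- Smooth compactly supported functions (`0`-forms) on `ℝ^m`; here `⊤ : ℕ∞` means `C^∞`. -/
abbrev Form0 (m : ℕ) : Type := TestFunction (⊤ : TopologicalSpace.Opens (E m)) ℝ (⊤ : ℕ∞)

/-- Smooth compactly supported `1`-forms on `ℝ^m`. -/
abbrev Form1 (m : ℕ) : Type :=
  TestFunction (⊤ : TopologicalSpace.Opens (E m)) (E m →L[ℝ] ℝ) (⊤ : ℕ∞)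

/-- `1`-currents in `ℝ^m`: continuous linear functionals on the space of smooth compactly
supported `1`-forms. -/
abbrev Current1 (m : ℕ) : Type := Form1 m →L[ℝ] ℝ

/-- The exterior derivative of a `0`-form. -/
def extDeriv0 {m : ℕ} (f : Form0 m) : Form1 m :=
  TestFunction.fderivCLM ℝ (⊤ : ℕ∞) (⊤ : ℕ∞) f

/-- The mass of a functional on `0`-forms (`F = ℝ`) or on `1`-forms (`F` the dual of `ℝ^m`). -/
def mass {m : ℕ} {F : Type} [NormedAddCommGroup F] [NormedSpace ℝ F]
    (T : TestFunction (⊤ : TopologicalSpace.Opens (E m)) F (⊤ : ℕ∞) → ℝ) : ℝ≥0∞ :=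
  ⨆ ω : TestFunction (⊤ : TopologicalSpace.Opens (E m)) F (⊤ : ℕ∞),
    ⨆ _ : ∀ x, ‖ω x‖ ≤ 1, ENNReal.ofReal (T ω)

/-- The boundary of a functional on `1`-forms: `∂T(f) = T(df)`. -/
def boundary {m : ℕ} (T : Form1 m → ℝ) : Form0 m → ℝ := fun f => T (extDeriv0 f)

/-- `T` is normal: `M(T) + M(∂T) < ∞`. -/
def IsNormal {m : ℕ} (T : Current1 m) : Prop :=
  mass (T : Form1 m → ℝ) + mass (boundary (T : Form1 m → ℝ)) < ∞

/-! ### Rectifiable `1`-currents -/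

/-- `M` is countably `1`-rectifiable. -/
def IsCountablyRectifiable {m : ℕ} (M : Set (E m)) : Prop :=
  ∃ (M₀ : Set (E m)) (F : ℕ → ℝ → E m),
    μH[1] M₀ = 0 ∧ (∀ j, ∃ K : ℝ≥0, LipschitzWith K (F j)) ∧ M ⊆ M₀ ∪ ⋃ j, range (F j)

/-- The line `P` is the approximate tangent space at `x` of the set `M` with multiplicity `θ`:
the blow-ups of `θ ℋ¹⌊M` at `x` converge weakly to `θ(x) ℋ¹⌊P`. -/
def IsApproxTangentLine {m : ℕ} (M : Set (E m)) (θ : E m → ℝ) (x : E m)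
    (P : Submodule ℝ (E m)) : Prop :=
  ∀ f : E m → ℝ, Continuous f → HasCompactSupport f →
    Tendsto (fun r : ℝ => r⁻¹ * ∫ z in M, f (r⁻¹ • (z - x)) * θ z ∂μH[1])
      (𝓝[>] 0) (𝓝 (θ x * ∫ v in (P : Set (E m)), f v ∂μH[1]))

/-- `T` is a rectifiable `1`-current: `T(ω) = ∫_M ⟨ω, ξ⟩ θ dℋ¹` with `M` an `ℋ¹`-measurable
countably `1`-rectifiable set, `θ` positive and locally `ℋ¹`-integrable on `M`, and `ξ` a measurable
unit vector field spanning the approximate tangent line of `M` almost everywhere. -/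
def IsRectifiable {m : ℕ} (T : Current1 m) : Prop :=
  ∃ (M : Set (E m)) (θ : E m → ℝ) (ξ : E m → E m),
    NullMeasurableSet M μH[1] ∧ IsCountablyRectifiable M ∧
    (∀ x ∈ M, 0 < θ x) ∧ LocallyIntegrable θ (μH[1].restrict M) ∧
    AEStronglyMeasurable ξ (μH[1].restrict M) ∧
    (∀ᵐ x ∂(μH[1].restrict M),
      ‖ξ x‖ = 1 ∧ IsApproxTangentLine M θ x (Submodule.span ℝ {ξ x})) ∧
    ∀ ω : Form1 m, T ω = ∫ x in M, ω x (ξ x) * θ x ∂μH[1]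

/-- `T` is a transport path from `μ` to `ν`: a rectifiable `1`-current with `∂T = ν - μ`. -/
def IsTransportPath {m : ℕ} (T : Current1 m) (μ ν : Measure (E m)) : Prop :=
  IsRectifiable T ∧
    ∀ f : Form0 m, boundary (T : Form1 m → ℝ) f = (∫ x, f x ∂ν) - ∫ x, f x ∂μ

/-! ### Curves -/

/-- The space `Γ` of eventually constant `1`-Lipschitz curves `[0,∞) → ℝ^m`. -/
structure LipCurve (m : ℕ) where
  /-- the underlying map -/
  toFun : ℝ≥0 → E m
  lipschitz : LipschitzWith 1 toFun
  eventuallyConst : ∃ t : ℝ≥0, ∀ s, t ≤ s → toFun s = toFun t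

namespace LipCurve

variable {m : ℕ}

instance : CoeFun (LipCurve m) (fun _ => ℝ≥0 → E m) := ⟨LipCurve.toFun⟩

/-- A curve as a continuous map. -/
def toContinuousMap (γ : LipCurve m) : C(ℝ≥0, E m) := ⟨γ.toFun, γ.lipschitz.continuous⟩

/-- `Γ` carries the topology of uniform convergence on compact sets. -/
instance : TopologicalSpace (LipCurve m) :=
  TopologicalSpace.induced toContinuousMap inferInstance

instance : MeasurableSpace (LipCurve m) := borel (LipCurve m)

instance : BorelSpace (LipCurve m) := ⟨rfl⟩

/-- `t₀(γ)`, the end of the initial interval of constancy (meaningful for non-constant `γ`). -/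
def tStart (γ : LipCurve m) : ℝ≥0 := sSup {t | ∀ s, s ≤ t → γ s = γ 0}

/-- `t_∞(γ)`, the beginning of the final interval of constancy. -/
def tEnd (γ : LipCurve m) : ℝ≥0 := sInf {t | ∀ s, t ≤ s → γ s = γ t}

/-- The starting point `p₀(γ) = γ(0)`. -/
def startPt (γ : LipCurve m) : E m := γ 0

/-- The end point `p_∞(γ) = lim_{t → ∞} γ(t)`. -/
def endPt (γ : LipCurve m) : E m := limUnder atTop (γ : ℝ≥0 → E m)

/-- `γ` is simple: injective on `[t₀(γ), t_∞(γ)]`. -/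
def IsSimple (γ : LipCurve m) : Prop :=
  ∀ s t : ℝ≥0, γ.tStart ≤ s → s < t → t ≤ γ.tEnd → γ s ≠ γ t

/-- `γ` is not constant. -/
def IsNonconstant (γ : LipCurve m) : Prop := ∃ t, γ t ≠ γ 0

/-- The velocity `γ'(t)`. -/
def velocity (γ : LipCurve m) (t : ℝ≥0) : E m := deriv (fun s : ℝ => γ s.toNNReal) (t : ℝ)

/-- The parameter in `[t₀(γ), t_∞(γ)]` of a point of the image of a simple curve. -/
def param (γ : LipCurve m) (x : E m) : ℝ≥0 :=
  Function.invFunOn (γ : ℝ≥0 → E m) (Icc γ.tStart γ.tEnd) x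

/-- The orientation `γ' / |γ'|` of a simple curve, as a vector field on its image. -/
def unitTangent (γ : LipCurve m) (x : E m) : E m :=
  ‖γ.velocity (γ.param x)‖⁻¹ • γ.velocity (γ.param x)

/-- The current `I_γ` of a simple curve: its image with multiplicity one, oriented by
`γ' / |γ'|`. -/
def current (γ : LipCurve m) : Form1 m → ℝ :=
  fun ω => ∫ x in range (γ : ℝ≥0 → E m), ω x (γ.unitTangent x) ∂μH[1]

end LipCurve

/-- The set `Γ_{x,y}` of curves from `x` to `y`. -/
def curvesBetween {m : ℕ} (x y : E m) : Set (LipCurve m) :=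
  {γ | γ.startPt = x ∧ γ.endPt = y}

/-! ### Good and better decompositions -/

/-- `η` is a good decomposition of the normal `1`-current `T`. -/
structure IsGoodDecomposition {m : ℕ} (η : Measure (LipCurve m)) (T : Current1 m) : Prop where
  normal : IsNormal T
  finite : IsFiniteMeasure η
  supported : ∀ᵐ γ ∂η, γ.IsNonconstant ∧ γ.IsSimple
  integrable : ∀ ω : Form1 m, Integrable (fun γ : LipCurve m => γ.current ω) η
  repr : ∀ ω : Form1 m, T ω = ∫ γ, γ.current ω ∂η
  mass_eq : mass (T : Form1 m → ℝ) = ∫⁻ γ, mass γ.current ∂η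
  mass_eq_length :
    ∫⁻ γ, mass γ.current ∂η = ∫⁻ γ, μH[1] (range (γ : ℝ≥0 → E m)) ∂η
  mass_boundary_eq :
    mass (boundary (T : Form1 m → ℝ)) = ∫⁻ γ, mass (boundary γ.current) ∂η
  mass_boundary_eq_two : ∫⁻ γ, mass (boundary γ.current) ∂η = 2 * η univ

/-- The index set of a family of `M ∈ ℕ ∪ {∞}` points (indices start from `0`). -/
abbrev Idx (M : ℕ∞) : Type := {i : ℕ // (i : ℕ∞) < M}

/-- The atomic measure `∑ i, a i • δ_{x i}`. -/
def atomicMeasure {m : ℕ} {M : ℕ∞} (a : Idx M → ℝ≥0) (x : Idx M → E m) : Measure (E m) :=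
  Measure.sum fun i => (a i : ℝ≥0∞) • Measure.dirac (x i)

/-- The unnormalized current `∫_{Γ_{x,y}} I_γ dη`. -/
def classCurrent {m : ℕ} (η : Measure (LipCurve m)) (x y : E m) : Form1 m → ℝ :=
  fun ω => ∫ γ in curvesBetween x y, γ.current ω ∂η

open Classical in
/-- The normalized current `S_{i,j}(η)`, for `x = x_i` and `y = y_j`. -/
def normalizedCurrent {m : ℕ} (η : Measure (LipCurve m)) (x y : E m) : Form1 m → ℝ :=
  if 0 < η (curvesBetween x y) then
    (η (curvesBetween x y)).toReal⁻¹ • classCurrent η x y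
  else 0

/-- `η` is a better decomposition of `T`, with respect to the sources `x` and the targets `y`. -/
def IsBetterDecomposition {m : ℕ} {M N : ℕ∞} (x : Idx M → E m) (y : Idx N → E m)
    (η : Measure (LipCurve m)) (T : Current1 m) : Prop :=
  IsGoodDecomposition η T ∧
    ∀ i₁ i₂ : Idx M, ∀ j₁ j₂ : Idx N, i₁ < i₂ → j₁ < j₂ →
      normalizedCurrent η (x i₁) (y j₁) - normalizedCurrent η (x i₁) (y j₂)
          - normalizedCurrent η (x i₂) (y j₁) + normalizedCurrent η (x i₂) (y j₂) = 0 →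
        η (curvesBetween (x i₁) (y j₁)) = 0 ∧ η (curvesBetween (x i₁) (y j₂)) = 0 ∧
        η (curvesBetween (x i₂) (y j₁)) = 0 ∧ η (curvesBetween (x i₂) (y j₂)) = 0

/-- The relation `η' ≼ η`: on each class `Γ_{x_i,y_j}` the current of `η'` is a nonnegative multiple
of the current of `η`. -/
def Precc {m : ℕ} {M N : ℕ∞} (x : Idx M → E m) (y : Idx N → E m)
    (η' η : Measure (LipCurve m)) : Prop :=
  ∀ (i : Idx M) (j : Idx N), ∃ c : ℝ, 0 ≤ c ∧
    classCurrent η' (x i) (y j) = c • classCurrent η (x i) (y j)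

end TransportPath

end

/-!
The mass identities of a good decomposition `η` forbid that a point is the start of some curves and
the end of others (`IsGoodDecomposition.eq_zero_of_le_marginals`). Hence almost every curve joins a
source to a target (`IsGoodDecomposition.ae_exists_mem_class`), and `η` amounts to a matrix of
weights `c i j = η (Γ_{x_i,y_j})` together with a normalized family of curves in each class.
Replacing `c` by a nonnegative matrix `w` gives the measure `redistribute η x y w`. It is again a
good decomposition of `T` as soon as `w` has the row and column sums of `c`, the superposed current
is still `T`, and the superposed length measures do not exceed those of `η`: then the mass of `T`
and the length of the curves bound each other, and all mass identities hold
(`IsGoodDecomposition.redistribute_good`). Call such a `w` a competitor if it also vanishes where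
`c` does.

A better decomposition comes from a competitor which maximizes `∑ 2⁻ⁱ 2⁻ʲ w i j`. Suppose that
`S i₁ j₁ - S i₁ j₂ - S i₂ j₁ + S i₂ j₂ = 0` with `i₁ < i₂` and `j₁ < j₂`. Comparing the boundaries
of the four currents, the four classes are all negligible or all of positive weight
(`IsGoodDecomposition.classes_pos_or_eq_zero`). In the second case, weight may be moved from
`(i₁, j₂)` and `(i₂, j₁)` to `(i₁, j₁)` and `(i₂, j₂)`. This keeps the row and column sums and the
current. It keeps the length measures as well: the curves are superposed without cancellation, so
that one test form nearly computes all the length measures at once, and these satisfy the same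
linear relation as the currents (`IsGoodDecomposition.classLength_add_eq`). The functional strictly
increases by this exchange, a contradiction
(`WeightedFamily.exists_competitor_forall_not_exchange`).

A maximizer exists because the competitors form a compact set for pointwise convergence
(`WeightedFamily.isCompact_competitors`). The row and column sums are fixed and summable, so no
weight escapes to infinity. No current does either, although the classes may be infinitely many and
their curves arbitrarily long: since `T` is rectifiable, its mass is carried up to `ε` by a set of
finite `ℋ¹`-measure (`IsGoodDecomposition.exists_hausdorffMeasure_lt_top`), on which a simple curve
has bounded length, so that classes of small total weight carry little length
(`WeightedFamily.eventually_tsum_compl_le`).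

The geometry of curves enters through the area formula `hausdorffMeasure_image_eq_lintegral_deriv`
for injective Lipschitz curves, which identifies the length measure of a simple curve with `ℋ¹` on
its image, and through the fundamental theorem of calculus for the current of a curve
(`LipCurve.IsSimple.boundary_current`).
-/

/-! ### The area formula for curves -/

namespace TransportPath

section AreaFormula

theorem enorm_le_enorm_add_of_norm_sub_le {F : Type*} [NormedAddCommGroup F]
    {u v : F} {δ : ℝ≥0} (h : ‖u - v‖ ≤ δ) :
    ‖u‖ₑ ≤ ‖v‖ₑ + δ := by
  have : ‖u‖₊ ≤ ‖v‖₊ + δ := by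
    have h1 : ‖u‖ ≤ ‖v‖ + δ := by linarith [norm_sub_norm_le u v]
    exact_mod_cast h1
  simpa [enorm_eq_nnnorm] using ENNReal.coe_le_coe.2 this

variable {F : Type*} [NormedAddCommGroup F] [NormedSpace ℝ F]

/-- If `f` is approximated on `s` by the linear map `A` up to `δ`, then at almost every point of `s`
its derivative differs from that of `A` by at most `δ`: this holds at every point of `s` that is
not isolated on the right, and the other points form a countable set. -/
theorem ae_norm_sub_le_of_approximatesLinearOn {f : ℝ → F} {A : ℝ →L[ℝ] F} {s : Set ℝ} {δ : ℝ≥0}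
    (hf : ApproximatesLinearOn f A s δ) {f' : ℝ → F} (hf' : ∀ x ∈ s, HasDerivAt f (f' x) x) :
    ∀ᵐ x, x ∈ s → ‖f' x - A 1‖ ≤ δ := by
  have hN : ({x ∈ s | 𝓝[s ∩ Ioi x] x = ⊥}).Countable :=
    countable_setOfPred_isolated_right_within
  filter_upwards [compl_mem_ae_iff.2 (hN.measure_zero volume)] with x hx hxs
  have hfreq : ∃ᶠ y in 𝓝[>] x, y ∈ s := by
    intro hev
    refine hx ⟨hxs, ?_⟩
    rw [← Filter.empty_mem_iff_bot, inter_comm, nhdsWithin_inter']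
    filter_upwards [mem_inf_of_left hev, mem_inf_of_right (mem_principal_self s)] with y h1 h2
    exact h1 h2
  have hlim : Tendsto (fun y => ‖slope f x y - A 1‖) (𝓝[>] x) (𝓝 ‖f' x - A 1‖) :=
    (((hasDerivAt_iff_tendsto_slope.1 (hf' x hxs)).mono_left
      (nhdsWithin_mono _ fun y hy => (ne_of_gt hy))).sub_const _).norm
  refine le_of_tendsto_of_frequently hlim ?_
  refine (hfreq.and_eventually self_mem_nhdsWithin).mono fun y hy => ?_
  have hpos : 0 < y - x := sub_pos.2 hy.2
  have h1 := hf y hy.1 x hxs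
  have h2 : slope f x y - A 1 = (y - x)⁻¹ • (f y - f x - A (y - x)) := by
    have h3 : A (y - x) = (y - x) • A 1 := by
      rw [← map_smul]; simp
    rw [slope_def_module, h3, smul_sub _ (f y - f x), smul_smul, inv_mul_cancel₀ hpos.ne', one_smul]
  rw [h2, norm_smul, norm_inv, Real.norm_of_nonneg hpos.le, inv_mul_le_iff₀ hpos, mul_comm]
  simpa [Real.norm_of_nonneg hpos.le] using h1

variable [MeasurableSpace F] [BorelSpace F]

theorem mul_volume_le_hausdorffMeasure_image {X : Type*} [MetricSpace X] [MeasurableSpace X]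
    [BorelSpace X] {f : ℝ → X} {s : Set ℝ} {c : ℝ≥0}
    (h : ∀ x ∈ s, ∀ y ∈ s, c * dist x y ≤ dist (f x) (f y)) :
    c * volume s ≤ μH[1] (f '' s) := by
  rcases eq_or_ne c 0 with rfl | hc
  · simp
  have hc' : (0 : ℝ) < c := by positivity
  have hinj : InjOn f s := by
    intro x hx y hy hxy
    have := h x hx y hy
    rw [hxy, dist_self] at this
    exact dist_le_zero.1 (nonpos_of_mul_nonpos_right this hc')
  have hlip : LipschitzOnWith c⁻¹ (Function.invFunOn f s) (f '' s) := by
    refine LipschitzOnWith.of_dist_le_mul ?_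
    rintro _ ⟨x, hx, rfl⟩ _ ⟨y, hy, rfl⟩
    rw [hinj.leftInvOn_invFunOn hx, hinj.leftInvOn_invFunOn hy, NNReal.coe_inv,
      le_inv_mul_iff₀ hc']
    exact h x hx y hy
  have h1 := hlip.hausdorffMeasure_image_le (d := 1) zero_le_one
  rw [hinj.leftInvOn_invFunOn.image_image, hausdorffMeasure_real, ENNReal.rpow_one,
    ENNReal.coe_inv hc] at h1
  have hc0 : (c : ℝ≥0∞) ≠ 0 := by simpa using hc
  calc (c : ℝ≥0∞) * volume s ≤ c * ((c : ℝ≥0∞)⁻¹ * μH[1] (f '' s)) := by gcongr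
    _ = μH[1] (f '' s) := by
      rw [← mul_assoc, ENNReal.mul_inv_cancel hc0 ENNReal.coe_ne_top, one_mul]

/-- On a piece where `f` is close to a linear map, the one-dimensional Hausdorff measure of the
image is close to the integral of the speed. -/
theorem hausdorffMeasure_image_bounds_of_approximatesLinearOn {f : ℝ → F} {A : ℝ →L[ℝ] F}
    {s : Set ℝ} {δ : ℝ≥0} (hs : MeasurableSet s) (hf : ApproximatesLinearOn f A s δ) {f' : ℝ → F}
    (hf' : ∀ x ∈ s, HasDerivAt f (f' x) x) :
    μH[1] (f '' s) ≤ (∫⁻ x in s, ‖f' x‖ₑ) + 2 * δ * volume s ∧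
      ∫⁻ x in s, ‖f' x‖ₑ ≤ μH[1] (f '' s) + 2 * δ * volume s := by
  have hae := (ae_restrict_iff' hs).2 (ae_norm_sub_le_of_approximatesLinearOn hf hf')
  have hA : ∀ x y : ℝ, ‖A (x - y)‖ = ‖A 1‖ * dist x y := by
    intro x y
    have h3 : A (x - y) = (x - y) • A 1 := by
      rw [← map_smul]; simp
    rw [h3, norm_smul, mul_comm, dist_eq_norm]
  constructor
  · have hlip : LipschitzOnWith (‖A 1‖₊ + δ) f s := by
      refine LipschitzOnWith.of_dist_le_mul fun x hx y hy => ?_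
      have h1 := hf x hx y hy
      have h2 := norm_sub_norm_le (f x - f y) (A (x - y))
      rw [hA] at h2
      rw [dist_eq_norm, NNReal.coe_add, coe_nnnorm, add_mul]
      rw [← dist_eq_norm x y] at h1
      linarith
    have h1 := hlip.hausdorffMeasure_image_le (d := 1) zero_le_one
    rw [hausdorffMeasure_real, ENNReal.rpow_one] at h1
    refine h1.trans ?_
    have h2 : ∫⁻ x in s, (‖A 1‖ₑ : ℝ≥0∞) ≤ ∫⁻ x in s, (‖f' x‖ₑ + δ) := by
      refine lintegral_mono_ae (hae.mono fun x hx => enorm_le_enorm_add_of_norm_sub_le ?_)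
      rwa [norm_sub_rev]
    rw [lintegral_add_right _ measurable_const, setLIntegral_const, setLIntegral_const] at h2
    calc ((‖A 1‖₊ + δ : ℝ≥0) : ℝ≥0∞) * volume s = ‖A 1‖ₑ * volume s + δ * volume s := by
          rw [ENNReal.coe_add, add_mul]; rfl
      _ ≤ ((∫⁻ x in s, ‖f' x‖ₑ) + δ * volume s) + δ * volume s := by gcongr
      _ = _ := by ring
  · have hexp : ∀ x ∈ s, ∀ y ∈ s, ((‖A 1‖₊ - δ : ℝ≥0) : ℝ) * dist x y ≤ dist (f x) (f y) := by
      intro x hx y hy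
      have h1 := hf x hx y hy
      have h2 := norm_sub_norm_le (A (x - y)) (f x - f y)
      rw [hA, norm_sub_rev (A (x - y))] at h2
      rw [← dist_eq_norm x y] at h1
      rcases le_total ‖A 1‖₊ δ with h | h
      · rw [tsub_eq_zero_of_le h]; simp
      · rw [NNReal.coe_sub h, sub_mul, coe_nnnorm, dist_eq_norm (f x)]
        linarith
    have h1 := mul_volume_le_hausdorffMeasure_image hexp
    have h2 : ∫⁻ x in s, ‖f' x‖ₑ ≤ ∫⁻ x in s, (‖A 1‖ₑ + δ) :=
      lintegral_mono_ae (hae.mono fun x hx => enorm_le_enorm_add_of_norm_sub_le hx)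
    rw [setLIntegral_const] at h2
    have h3 : (‖A 1‖ₑ : ℝ≥0∞) ≤ ((‖A 1‖₊ - δ : ℝ≥0) : ℝ≥0∞) + δ := by
      have : ‖A 1‖₊ ≤ (‖A 1‖₊ - δ) + δ := le_tsub_add
      exact_mod_cast this
    calc ∫⁻ x in s, ‖f' x‖ₑ ≤ (‖A 1‖ₑ + δ) * volume s := h2
      _ ≤ (((‖A 1‖₊ - δ : ℝ≥0) : ℝ≥0∞) + δ + δ) * volume s := by gcongr
      _ = ((‖A 1‖₊ - δ : ℝ≥0) : ℝ≥0∞) * volume s + 2 * δ * volume s := by ring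
      _ ≤ _ := by gcongr

/-- The area formula for an injective differentiable curve. -/
theorem hausdorffMeasure_image_eq_lintegral [CompleteSpace F] [SecondCountableTopology F]
    {f f' : ℝ → F} {s : Set ℝ} (hs : MeasurableSet s) (hfin : volume s ≠ ∞)
    (hf' : ∀ x ∈ s, HasDerivAt f (f' x) x) (hinj : InjOn f s) :
    μH[1] (f '' s) = ∫⁻ x in s, ‖f' x‖ₑ := by
  have key : ∀ δ : ℝ≥0, δ ≠ 0 →
      μH[1] (f '' s) ≤ (∫⁻ x in s, ‖f' x‖ₑ) + 2 * δ * volume s ∧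
      ∫⁻ x in s, ‖f' x‖ₑ ≤ μH[1] (f '' s) + 2 * δ * volume s := by
    intro δ hδ
    -- Cut `s` into pieces on which `f` is linear up to `δ`, and add the errors `2 * δ * volume`.
    obtain ⟨t, A, hdisj, hmeas, hcov, happ, -⟩ :=
      exists_partition_approximatesLinearOn_of_hasFDerivWithinAt f s
        (fun x => ContinuousLinearMap.toSpanSingleton ℝ (f' x))
        (fun x hx => (hf' x hx).hasFDerivAt.hasFDerivWithinAt) (fun _ => δ) (fun _ => hδ)
    have hst : ⋃ n, s ∩ t n = s := by rw [← inter_iUnion]; exact inter_eq_left.2 hcov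
    have hm : ∀ n, MeasurableSet (s ∩ t n) := fun n => hs.inter (hmeas n)
    have hd : Pairwise (Function.onFun Disjoint fun n => s ∩ t n) := fun i j hij =>
      (hdisj hij).mono inter_subset_right inter_subset_right
    have hb := fun n => hausdorffMeasure_image_bounds_of_approximatesLinearOn (hm n) (happ n)
      (fun x hx => hf' x hx.1)
    have hint : ∫⁻ x in s, ‖f' x‖ₑ = ∑' n, ∫⁻ x in s ∩ t n, ‖f' x‖ₑ := by
      rw [← lintegral_iUnion hm hd, hst]
    have hvol : volume s = ∑' n, volume (s ∩ t n) := by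
      rw [← measure_iUnion hd hm, hst]
    have himg : μH[1] (f '' s) = ∑' n, μH[1] (f '' (s ∩ t n)) := by
      rw [← measure_iUnion, ← image_iUnion, hst]
      · intro i j hij
        exact disjoint_image_image fun x hx y hy hxy =>
          (disjoint_left.1 (hd hij) hx) (hinj hx.1 hy.1 hxy ▸ hy)
      · intro n
        exact (hm n).image_of_continuousOn_injOn
          (fun x hx => (hf' x hx.1).continuousAt.continuousWithinAt) (hinj.mono inter_subset_left)
    rw [himg, hint, hvol, ← ENNReal.tsum_mul_left, ← ENNReal.tsum_add, ← ENNReal.tsum_add]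
    exact ⟨ENNReal.tsum_le_tsum fun n => (hb n).1, ENNReal.tsum_le_tsum fun n => (hb n).2⟩
  have hlim : ∀ a : ℝ≥0∞, Tendsto (fun n : ℕ => a + 2 * (((n : ℝ≥0) + 1)⁻¹ : ℝ≥0) * volume s) atTop
      (𝓝 a) := by
    intro a
    have h0 : Tendsto (fun n : ℕ => (((n : ℝ≥0) + 1)⁻¹ : ℝ≥0)) atTop (𝓝 0) := by
      simpa using tendsto_one_div_add_atTop_nhds_zero_nat (𝕜 := ℝ≥0)
    have h1 : Tendsto (fun n : ℕ => ((((n : ℝ≥0) + 1)⁻¹ : ℝ≥0) : ℝ≥0∞)) atTop (𝓝 0) := by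
      rw [← ENNReal.coe_zero]; exact ENNReal.tendsto_coe.2 h0
    have h2 := ENNReal.Tendsto.mul_const (b := volume s)
      (ENNReal.Tendsto.const_mul (a := 2) h1 (Or.inr (by simp))) (Or.inr hfin)
    simpa using tendsto_const_nhds.add h2
  apply le_antisymm
  · exact ge_of_tendsto' (hlim _) fun n => (key _ (by positivity)).1
  · exact ge_of_tendsto' (hlim _) fun n => (key _ (by positivity)).2

/-- The area formula for Lipschitz curves. -/
theorem hausdorffMeasure_image_eq_lintegral_deriv [FiniteDimensional ℝ F] {f : ℝ → F} {K : ℝ≥0}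
    (hf : LipschitzWith K f) {s : Set ℝ} (hs : MeasurableSet s) (hfin : volume s ≠ ∞)
    (hinj : InjOn f s) : μH[1] (f '' s) = ∫⁻ x in s, ‖deriv f x‖ₑ := by
  have : CompleteSpace F := FiniteDimensional.complete ℝ F
  have : SecondCountableTopology F := by
    have := FiniteDimensional.proper ℝ F
    infer_instance
  have hdm : MeasurableSet {x | DifferentiableAt ℝ f x} := measurableSet_of_differentiableAt ℝ f
  set t := s ∩ {x | DifferentiableAt ℝ f x}
  have htm : MeasurableSet t := hs.inter hdm
  have hnull : volume (s \ t) = 0 := by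
    refine measure_mono_null ?_ (ae_iff.1 (hf.ae_differentiableAt (μ := volume)))
    rintro x ⟨hxs, hxt⟩ hd
    exact hxt ⟨hxs, hd⟩
  have hst : (t : Set ℝ) =ᵐ[volume] s :=
    (ae_eq_set.2 ⟨by rw [sdiff_eq_empty.2 inter_subset_left]; simp, hnull⟩)
  have h1 := hausdorffMeasure_image_eq_lintegral htm
    (ne_top_of_le_ne_top hfin (measure_mono inter_subset_left))
    (fun x hx => (hx.2 : DifferentiableAt ℝ f x).hasDerivAt) (hinj.mono inter_subset_left)
  rw [setLIntegral_congr hst] at h1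
  rw [← h1]
  apply le_antisymm _ (measure_mono (image_mono inter_subset_left))
  have h2 : μH[1] (f '' (s \ t)) = 0 := by
    have := (hf.hausdorffMeasure_image_le (d := 1) zero_le_one (s \ t))
    rw [hausdorffMeasure_real, hnull] at this
    simpa using this
  calc μH[1] (f '' s) = μH[1] (f '' (t ∪ s \ t)) := by
        rw [union_sdiff_cancel inter_subset_left]
    _ ≤ μH[1] (f '' t) + μH[1] (f '' (s \ t)) := by
        rw [image_union]; exact measure_union_le _ _
    _ = _ := by rw [h2, add_zero]

end AreaFormula

end TransportPath

/-! ### Curves, their length measures and their currents -/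

namespace TransportPath

namespace LipCurve

variable {m : ℕ} (γ : LipCurve m)

/-- The curve extended to `ℝ` by its initial value. -/
noncomputable def extend (t : ℝ) : E m := γ t.toNNReal

theorem lipschitzWith_extend : LipschitzWith 1 γ.extend := by
  have := γ.lipschitz.comp Real.lipschitzWith_toNNReal
  rwa [one_mul] at this

theorem continuous_extend : Continuous γ.extend := γ.lipschitzWith_extend.continuous

theorem velocity_toNNReal {t : ℝ} (ht : 0 ≤ t) : γ.velocity t.toNNReal = deriv γ.extend t := by
  simp only [velocity, Real.coe_toNNReal t ht]
  rfl

/-- A curve is constant after `tEnd`: the infimum in the definition of `tEnd` is attained. -/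
theorem eq_tEnd_of_le {s : ℝ≥0} (hs : γ.tEnd ≤ s) : γ s = γ γ.tEnd := by
  have hne : {t : ℝ≥0 | ∀ s, t ≤ s → γ s = γ t}.Nonempty := γ.eventuallyConst
  have key : ∀ s, γ.tEnd < s → ∀ s', γ.tEnd < s' → γ s = γ s' := by
    intro s hs s' hs'
    obtain ⟨t, ht, hts⟩ := exists_lt_of_csInf_lt hne (lt_min hs hs')
    rw [ht s (hts.le.trans (min_le_left _ _)), ht s' (hts.le.trans (min_le_right _ _))]
  have hlim : Tendsto (fun s' => γ s') (𝓝[>] γ.tEnd) (𝓝 (γ γ.tEnd)) :=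
    (γ.lipschitz.continuous.tendsto _).mono_left nhdsWithin_le_nhds
  rcases hs.eq_or_lt with h | h
  · rw [h]
  · refine tendsto_nhds_unique (tendsto_const_nhds.congr' ?_) hlim
    filter_upwards [self_mem_nhdsWithin] with s' hs'
    exact key s h s' hs'

theorem endPt_eq : γ.endPt = γ γ.tEnd := by
  refine Tendsto.limUnder_eq (tendsto_const_nhds.congr' ?_)
  filter_upwards [eventually_ge_atTop γ.tEnd] with s hs
  exact (γ.eq_tEnd_of_le hs).symm

variable {γ}

/-- A curve is constant before `tStart`. This includes constant curves, for which the supremum in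
the definition of `tStart` is over an unbounded set and has the value `0`. -/
theorem eq_zero_of_le_tStart {s : ℝ≥0} (hs : s ≤ γ.tStart) :
    γ s = γ 0 := by
  have key : ∀ s, s < γ.tStart → γ s = γ 0 := by
    intro s hs
    obtain ⟨t, ht, hts⟩ := exists_lt_of_lt_csSup ⟨0, fun s hs => by rw [nonpos_iff_eq_zero.1 hs]⟩ hs
    exact ht s hts.le
  rcases hs.eq_or_lt with h' | h'
  · rcases eq_or_ne s 0 with rfl | h0
    · rfl
    have hlim : Tendsto (fun s' => γ s') (𝓝[<] s) (𝓝 (γ s)) :=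
      (γ.lipschitz.continuous.tendsto _).mono_left nhdsWithin_le_nhds
    have : (𝓝[<] s).NeBot := nhdsLT_neBot_of_exists_lt ⟨0, pos_iff_ne_zero.2 h0⟩
    refine tendsto_nhds_unique hlim (tendsto_const_nhds.congr' ?_)
    filter_upwards [self_mem_nhdsWithin] with s' hs'
    exact (key s' (h' ▸ hs')).symm
  · exact key s h'

theorem IsNonconstant.tStart_lt_tEnd (h : γ.IsNonconstant) : γ.tStart < γ.tEnd := by
  by_contra hle
  rw [not_lt] at hle
  obtain ⟨t, ht⟩ := h
  apply ht
  rcases le_total t γ.tStart with h1 | h1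
  · exact eq_zero_of_le_tStart h1
  · rw [γ.eq_tEnd_of_le (hle.trans h1), eq_zero_of_le_tStart hle]

theorem IsNonconstant.range_eq (h : γ.IsNonconstant) :
    range (γ : ℝ≥0 → E m) = γ.extend '' Icc (γ.tStart : ℝ) γ.tEnd := by
  apply Subset.antisymm
  · rintro _ ⟨t, rfl⟩
    have hlt := h.tStart_lt_tEnd
    rcases le_total t γ.tStart with h1 | h1
    · refine ⟨γ.tStart, ⟨le_rfl, by exact_mod_cast hlt.le⟩, ?_⟩
      rw [extend, Real.toNNReal_coe, eq_zero_of_le_tStart h1, eq_zero_of_le_tStart le_rfl]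
    rcases le_total t γ.tEnd with h2 | h2
    · exact ⟨t, ⟨by exact_mod_cast h1, by exact_mod_cast h2⟩, by rw [extend, Real.toNNReal_coe]⟩
    · refine ⟨γ.tEnd, ⟨by exact_mod_cast hlt.le, le_rfl⟩, ?_⟩
      rw [extend, Real.toNNReal_coe, γ.eq_tEnd_of_le h2]
  · rintro _ ⟨t, -, rfl⟩
    exact ⟨_, rfl⟩

theorem IsSimple.injOn_Icc (h : γ.IsSimple) :
    InjOn (γ : ℝ≥0 → E m) (Icc γ.tStart γ.tEnd) := by
  intro s hs t ht hst
  by_contra hne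
  rcases lt_or_gt_of_ne hne with h1 | h1
  · exact h s t hs.1 h1 ht.2 hst
  · exact h t s ht.1 h1 hs.2 hst.symm

theorem toNNReal_mem_Icc {t : ℝ} (ht : t ∈ Icc (γ.tStart : ℝ) γ.tEnd) :
    t.toNNReal ∈ Icc γ.tStart γ.tEnd :=
  ⟨NNReal.le_toNNReal_of_coe_le ht.1, Real.toNNReal_le_iff_le_coe.2 ht.2⟩

theorem IsSimple.injOn_extend (h : γ.IsSimple) :
    InjOn γ.extend (Icc (γ.tStart : ℝ) γ.tEnd) := by
  intro s hs t ht hst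
  have := h.injOn_Icc (toNNReal_mem_Icc hs) (toNNReal_mem_Icc ht) hst
  have hs0 : 0 ≤ s := γ.tStart.2.trans hs.1
  have ht0 : 0 ≤ t := γ.tStart.2.trans ht.1
  exact (Real.toNNReal_eq_toNNReal_iff hs0 ht0).1 this

theorem IsSimple.startPt_ne_endPt (h : γ.IsSimple) (hn : γ.IsNonconstant) :
    γ.startPt ≠ γ.endPt := by
  rw [endPt_eq, startPt, ← eq_zero_of_le_tStart le_rfl]
  exact h _ _ le_rfl hn.tStart_lt_tEnd le_rfl

theorem deriv_extend_eq_zero_of_tEnd_lt {t : ℝ} (ht : γ.tEnd < t) : deriv γ.extend t = 0 := by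
  have : γ.extend =ᶠ[𝓝 t] fun _ => γ γ.tEnd := by
    filter_upwards [Ioi_mem_nhds ht] with s hs
    exact γ.eq_tEnd_of_le (NNReal.le_toNNReal_of_coe_le (le_of_lt hs))
  rw [this.deriv_eq, deriv_const]

theorem deriv_extend_eq_zero_of_neg {t : ℝ} (ht : t < 0) : deriv γ.extend t = 0 := by
  have : γ.extend =ᶠ[𝓝 t] fun _ => γ 0 := by
    filter_upwards [Iio_mem_nhds ht] with s hs
    rw [extend, Real.toNNReal_of_nonpos (le_of_lt hs)]
  rw [this.deriv_eq, deriv_const]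

theorem deriv_extend_eq_zero_of_lt_tStart {t : ℝ} (ht : t < γ.tStart) : deriv γ.extend t = 0 := by
  have : γ.extend =ᶠ[𝓝 t] fun _ => γ 0 := by
    filter_upwards [Iio_mem_nhds ht] with s hs
    exact eq_zero_of_le_tStart (Real.toNNReal_le_iff_le_coe.2 (le_of_lt hs))
  rw [this.deriv_eq, deriv_const]

theorem deriv_extend_eq_zero {t : ℝ}
    (ht : t ∉ Icc (γ.tStart : ℝ) γ.tEnd) : deriv γ.extend t = 0 := by
  rw [mem_Icc, not_and_or, not_le, not_le] at ht
  exact ht.elim deriv_extend_eq_zero_of_lt_tStart deriv_extend_eq_zero_of_tEnd_lt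

variable (γ)

/-- The speed measure `|γ'(t)| dt` on the parameter line. -/
noncomputable def speedMeasure : Measure ℝ := volume.withDensity fun t => ‖deriv γ.extend t‖ₑ

/-- The length measure of a curve: the image of `|γ'(t)| dt` under `γ`. For a simple curve it is the
restriction of `ℋ¹` to the image, see `IsSimple.hausdorffMeasure_restrict_range`. -/
noncomputable def lengthMeasure : Measure (E m) := γ.speedMeasure.map γ.extend

theorem lengthMeasure_apply {A : Set (E m)} (hA : MeasurableSet A) :
    γ.lengthMeasure A = ∫⁻ t in γ.extend ⁻¹' A, ‖deriv γ.extend t‖ₑ := by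
  rw [lengthMeasure, Measure.map_apply γ.continuous_extend.measurable hA, speedMeasure,
    withDensity_apply _ (γ.continuous_extend.measurable hA)]

theorem speedMeasure_restrict :
    γ.speedMeasure.restrict (Icc (γ.tStart : ℝ) γ.tEnd) = γ.speedMeasure := by
  refine Measure.restrict_eq_self_of_ae_mem ?_
  rw [ae_iff]
  have : {t : ℝ | t ∉ Icc (γ.tStart : ℝ) γ.tEnd} = (Icc (γ.tStart : ℝ) γ.tEnd)ᶜ := rfl
  rw [this, speedMeasure, withDensity_apply _ measurableSet_Icc.compl,
    setLIntegral_congr_fun measurableSet_Icc.compl (g := fun _ => 0)]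
  · simp
  · intro t ht
    simp [deriv_extend_eq_zero ht]

variable {γ}

theorem IsSimple.hausdorffMeasure_restrict_range (h : γ.IsSimple) (hn : γ.IsNonconstant) :
    (μH[1] : Measure (E m)).restrict (range (γ : ℝ≥0 → E m)) = γ.lengthMeasure := by
  ext A hA
  have hpre : MeasurableSet (γ.extend ⁻¹' A) := γ.continuous_extend.measurable hA
  rw [Measure.restrict_apply hA, lengthMeasure,
    Measure.map_apply γ.continuous_extend.measurable hA, ← γ.speedMeasure_restrict,
    Measure.restrict_apply hpre, speedMeasure, withDensity_apply _ (hpre.inter measurableSet_Icc),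
    ← hausdorffMeasure_image_eq_lintegral_deriv γ.lipschitzWith_extend
      (hpre.inter measurableSet_Icc), hn.range_eq, inter_comm A, inter_comm (_ ⁻¹' _),
      image_inter_preimage]
  · exact ne_top_of_le_ne_top (by simp) (measure_mono inter_subset_right)
  · exact h.injOn_extend.mono inter_subset_right

instance : IsFiniteMeasure γ.lengthMeasure := by
  refine ⟨?_⟩
  rw [lengthMeasure_apply _ MeasurableSet.univ, preimage_univ, Measure.restrict_univ]
  have h0 : ∀ t, ‖deriv γ.extend t‖ₑ ≤ (Icc (0 : ℝ) γ.tEnd).indicator 1 t := by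
    intro t
    by_cases ht : t ∈ Icc (0 : ℝ) γ.tEnd
    · rw [indicator_of_mem ht]
      have h1 : ‖deriv γ.extend t‖ ≤ 1 := by
        simpa using norm_deriv_le_of_lipschitz γ.lipschitzWith_extend (x₀ := t)
      have h2 : ‖deriv γ.extend t‖₊ ≤ 1 := h1
      simpa [enorm_eq_nnnorm] using h2
    · rw [mem_Icc, not_and_or, not_le, not_le] at ht
      rcases ht with ht | ht
      · simp [deriv_extend_eq_zero_of_neg ht]
      · simp [deriv_extend_eq_zero_of_tEnd_lt ht]
  calc ∫⁻ t, ‖deriv γ.extend t‖ₑ ≤ ∫⁻ t, (Icc (0 : ℝ) γ.tEnd).indicator 1 t := lintegral_mono h0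
    _ = volume (Icc (0 : ℝ) γ.tEnd) := lintegral_indicator_one measurableSet_Icc
    _ < ∞ := by simp

/-- The current of a simple curve as an integral over the parameter. -/
theorem IsSimple.current_eq (h : γ.IsSimple) (hn : γ.IsNonconstant) (ω : Form1 m) :
    γ.current ω = ∫ t, ω (γ.extend t) (deriv γ.extend t) := by
  set I := Icc (γ.tStart : ℝ) γ.tEnd
  have he : MeasurableEmbedding fun t : I => γ.extend t :=
    (γ.continuous_extend.comp continuous_subtype_val).measurableEmbedding
      (injOn_iff_injective.1 h.injOn_extend)
  have hlen : γ.lengthMeasure = (γ.speedMeasure.comap (Subtype.val : I → ℝ)).map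
      fun t : I => γ.extend t := by
    have h1 : γ.lengthMeasure = (γ.speedMeasure.restrict I).map γ.extend := by
      rw [γ.speedMeasure_restrict, lengthMeasure]
    rw [h1, ← map_comap_subtype_coe measurableSet_Icc,
      Measure.map_map γ.continuous_extend.measurable measurable_subtype_coe]
    rfl
  have hmeas : Measurable fun t => ‖deriv γ.extend t‖₊ := (measurable_deriv _).nnnorm
  rw [current, h.hausdorffMeasure_restrict_range hn, hlen, he.integral_map,
    integral_subtype_comap measurableSet_Icc (fun t => ω (γ.extend t) (γ.unitTangent (γ.extend t))),
    speedMeasure, restrict_withDensity measurableSet_Icc]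
  simp_rw [enorm_eq_nnnorm]
  rw [integral_withDensity_eq_integral_smul hmeas]
  rw [← setIntegral_eq_integral_of_forall_compl_eq_zero (s := I) (μ := volume)
    (f := fun t => ω (γ.extend t) (deriv γ.extend t))]
  · refine setIntegral_congr_fun measurableSet_Icc fun t ht => ?_
    have hp : γ.param (γ.extend t) = t.toNNReal :=
      h.injOn_Icc.leftInvOn_invFunOn (toNNReal_mem_Icc ht)
    have ht0 : 0 ≤ t := γ.tStart.2.trans ht.1
    simp only [unitTangent, hp, γ.velocity_toNNReal ht0, map_smul, NNReal.smul_def, coe_nnnorm,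
      smul_eq_mul]
    rcases eq_or_ne (deriv γ.extend t) 0 with h0 | h0
    · simp [h0]
    · rw [mul_inv_cancel_left₀ (norm_ne_zero_iff.2 h0)]
  · intro t ht
    simp [deriv_extend_eq_zero ht]

theorem extDeriv0_apply (f : Form0 m) (x : E m) : extDeriv0 f x = fderiv ℝ f x := by
  simp [extDeriv0]

/-- Stokes' theorem for simple curves. -/
theorem IsSimple.boundary_current (h : γ.IsSimple) (hn : γ.IsNonconstant) (f : Form0 m) :
    boundary γ.current f = f γ.endPt - f γ.startPt := by
  obtain ⟨K, hK⟩ := f.contDiff.lipschitzWith_of_hasCompactSupport f.hasCompactSupport (by simp)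
  have hF : LipschitzWith (K * 1) (f ∘ γ.extend) := hK.comp γ.lipschitzWith_extend
  have hE : (0 : ℝ) ≤ γ.tEnd := γ.tEnd.2
  have hac : AbsolutelyContinuousOnInterval (f ∘ γ.extend) 0 γ.tEnd :=
    (hF.lipschitzOnWith (s := uIcc (0 : ℝ) γ.tEnd)).absolutelyContinuousOnInterval
  have h1 := hac.integral_deriv_eq_sub
  rw [intervalIntegral.integral_of_le hE, ← integral_Icc_eq_integral_Ioc] at h1
  have hend : (f ∘ γ.extend) γ.tEnd = f γ.endPt := by simp [extend, endPt_eq]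
  have hstart : (f ∘ γ.extend) 0 = f γ.startPt := by simp [extend, startPt]
  rw [hend, hstart] at h1
  rw [← h1, boundary, h.current_eq hn,
    ← setIntegral_eq_integral_of_forall_compl_eq_zero (s := Icc (0 : ℝ) γ.tEnd)]
  · refine setIntegral_congr_ae measurableSet_Icc ?_
    filter_upwards [γ.lipschitzWith_extend.ae_differentiableAt (μ := volume)] with t ht _
    rw [extDeriv0_apply, fderiv_comp_deriv _
      ((f.contDiff.differentiable (by simp)).differentiableAt) ht]
  · intro t ht
    rw [mem_Icc, not_and_or, not_le, not_le] at ht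
    rcases ht with ht | ht
    · simp [deriv_extend_eq_zero_of_neg ht]
    · simp [deriv_extend_eq_zero_of_tEnd_lt ht]

instance : SecondCountableTopology (LipCurve m) :=
  have h : Topology.IsInducing (toContinuousMap (m := m)) := ⟨rfl⟩
  h.secondCountableTopology

theorem continuous_uncurry_extend :
    Continuous (Function.uncurry fun (γ : LipCurve m) t => γ.extend t) := by
  have h1 : Continuous (toContinuousMap (m := m)) := continuous_induced_dom
  have h2 : Continuous fun p : LipCurve m × ℝ => (toContinuousMap p.1) p.2.toNNReal := by
    fun_prop
  exact h2

theorem measurable_lengthMeasure :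
    Measurable (lengthMeasure : LipCurve m → Measure (E m)) := by
  refine Measure.measurable_of_measurable_coe _ fun A hA => ?_
  have h1 : Measurable fun p : LipCurve m × ℝ => ‖deriv p.1.extend p.2‖ₑ :=
    (measurable_deriv_with_param (f := fun (γ : LipCurve m) t => γ.extend t)
      continuous_uncurry_extend).enorm
  have hS : MeasurableSet {p : LipCurve m × ℝ | p.1.extend p.2 ∈ A} :=
    continuous_uncurry_extend.measurable hA
  have h2 := (h1.indicator hS).lintegral_prod_right' (ν := (volume : Measure ℝ))
  convert h2 using 2 with γ
  rw [lengthMeasure_apply _ hA, ← lintegral_indicator (γ.continuous_extend.measurable hA)]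
  rfl

theorem continuous_startPt : Continuous (startPt : LipCurve m → E m) := by
  have h1 : Continuous (toContinuousMap (m := m)) := continuous_induced_dom
  exact (continuous_eval_const (F := C(ℝ≥0, E m)) (0 : ℝ≥0)).comp h1

theorem measurable_endPt : Measurable (endPt : LipCurve m → E m) := by
  have h1 : Continuous (toContinuousMap (m := m)) := continuous_induced_dom
  refine measurable_of_tendsto_metrizable (f := fun (n : ℕ) (γ : LipCurve m) => γ (n : ℝ≥0))
    (fun n => ((continuous_eval_const (F := C(ℝ≥0, E m)) (n : ℝ≥0)).comp h1).measurable) ?_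
  refine tendsto_pi_nhds.2 fun γ => ?_
  refine tendsto_const_nhds.congr' ?_
  filter_upwards [tendsto_natCast_atTop_atTop.eventually_ge_atTop γ.tEnd] with n hn
  rw [endPt_eq, γ.eq_tEnd_of_le hn]

end LipCurve

theorem measurableSet_curvesBetween {m : ℕ} (x y : E m) : MeasurableSet (curvesBetween x y) :=
  (LipCurve.continuous_startPt.measurable (measurableSet_singleton x)).inter
    (LipCurve.measurable_endPt (measurableSet_singleton y))

end TransportPath

/-! ### Test functions -/

namespace TransportPath

variable {m : ℕ}

open scoped Manifold in
/-- Smooth Urysohn functions as test functions. -/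
theorem exists_form0_one_on_compact {K U : Set (E m)} (hK : IsCompact K) (hU : IsOpen U)
    (hKU : K ⊆ U) :
    ∃ χ : Form0 m, (∀ x, 0 ≤ χ x) ∧ (∀ x, χ x ≤ 1) ∧ (∀ x ∈ K, χ x = 1) ∧ ∀ x ∉ U, χ x = 0 := by
  obtain ⟨L, hL, hKL, hLU⟩ := exists_compact_between hK hU hKU
  obtain ⟨f, hf0, hf1, hf⟩ := exists_contMDiffMap_zero_one_of_isClosed (n := (⊤ : ℕ∞))
    (𝓘(ℝ, E m)) (isOpen_interior (s := L)).isClosed_compl hK.isClosed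
    (disjoint_compl_left_iff_subset.2 hKL)
  have hz : ∀ x ∉ L, f x = 0 := fun x hx => hf0 fun h => hx (interior_subset h)
  refine ⟨⟨f, f.contMDiff.contDiff, HasCompactSupport.intro hL hz, subset_univ _⟩,
    fun x => (hf x).1, fun x => (hf x).2, fun x hx => hf1 hx, fun x hx => hz x fun h => hx (hLU h)⟩

/-- The product of a `0`-form and a `1`-form. -/
noncomputable def mulForm (χ : Form0 m) (ω : Form1 m) : Form1 m where
  toFun x := χ x • ω x
  contDiff' := χ.contDiff.smul ω.contDiff
  hasCompactSupport' := χ.hasCompactSupport.smul_right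
  tsupport_subset' := subset_univ _

@[simp]
theorem mulForm_apply (χ : Form0 m) (ω : Form1 m) (x : E m) : mulForm χ ω x = χ x • ω x := rfl

/-- Test functions detect inequalities between Radon measures. -/
theorem measure_le_of_forall_form0 {μ ν : Measure (E m)} [IsLocallyFiniteMeasure μ]
    [IsLocallyFiniteMeasure ν]
    (h : ∀ χ : Form0 m, (∀ x, 0 ≤ χ x) → (∀ x, χ x ≤ 1) →
      ∫⁻ x, ENNReal.ofReal (χ x) ∂μ ≤ ∫⁻ x, ENNReal.ofReal (χ x) ∂ν) : μ ≤ ν := by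
  refine Measure.le_iff.2 fun A hA => ?_
  rw [hA.measure_eq_iSup_isCompact]
  refine iSup₂_le fun K hKA => iSup_le fun hK => le_trans ?_ (measure_mono hKA)
  rw [K.measure_eq_iInf_isOpen ν]
  refine le_iInf₂ fun U hKU => le_iInf fun hU => ?_
  obtain ⟨χ, h0, h1, hχK, hχU⟩ := exists_form0_one_on_compact hK hU hKU
  calc μ K = ∫⁻ x, K.indicator 1 x ∂μ := (lintegral_indicator_one hK.measurableSet).symm
    _ ≤ ∫⁻ x, ENNReal.ofReal (χ x) ∂μ := by
      refine lintegral_mono fun x => ?_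
      by_cases hx : x ∈ K
      · simp [hx, hχK x hx]
      · simp [hx]
    _ ≤ ∫⁻ x, ENNReal.ofReal (χ x) ∂ν := h χ h0 h1
    _ ≤ ∫⁻ x, U.indicator 1 x ∂ν := by
      refine lintegral_mono fun x => ?_
      by_cases hx : x ∈ U
      · simpa [hx] using h1 x
      · simp [hx, hχU x hx]
    _ = ν U := lintegral_indicator_one hU.measurableSet

theorem exists_norm_form1_le (ω : Form1 m) : ∃ C : ℝ≥0, ∀ x, ‖ω x‖ ≤ C := by
  obtain ⟨C, hC⟩ := ω.continuous.bounded_above_of_compact_support ω.hasCompactSupport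
  exact ⟨⟨C, (norm_nonneg _).trans (hC 0)⟩, hC⟩

theorem integrable_form0 (χ : Form0 m) (μ : Measure (E m)) [IsFiniteMeasure μ] :
    Integrable (fun x => χ x) μ := by
  obtain ⟨C, hC⟩ := χ.continuous.bounded_above_of_compact_support χ.hasCompactSupport
  exact Integrable.of_bound χ.continuous.aestronglyMeasurable C (ae_of_all _ hC)

theorem integrable_norm_form1 (ω : Form1 m) (μ : Measure (E m)) [IsFiniteMeasure μ] :
    Integrable (fun x => ‖ω x‖) μ := by
  obtain ⟨C, hC⟩ := exists_norm_form1_le ω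
  exact Integrable.of_bound ω.continuous.norm.aestronglyMeasurable C
    (ae_of_all _ fun x => by simpa using hC x)

/-! ### Comparison of the current of a curve with its length measure -/

namespace LipCurve

variable {γ : LipCurve m}

theorem integrable_deriv_extend : Integrable (deriv γ.extend) volume := by
  refine ⟨(stronglyMeasurable_deriv _).aestronglyMeasurable, ?_⟩
  have h := measure_lt_top γ.lengthMeasure univ
  rwa [lengthMeasure_apply _ MeasurableSet.univ, preimage_univ, Measure.restrict_univ] at h

theorem integral_lengthMeasure {h : E m → ℝ} (hh : Continuous h) :
    ∫ x, h x ∂γ.lengthMeasure = ∫ t, h (γ.extend t) * ‖deriv γ.extend t‖ := by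
  have hmeas : Measurable fun t => ‖deriv γ.extend t‖₊ := (measurable_deriv _).nnnorm
  rw [lengthMeasure, integral_map γ.continuous_extend.measurable.aemeasurable
    hh.aestronglyMeasurable, speedMeasure]
  simp_rw [enorm_eq_nnnorm]
  rw [integral_withDensity_eq_integral_smul hmeas]
  simp [NNReal.smul_def, mul_comm]

theorem integrable_form1_extend (ω : Form1 m) :
    Integrable (fun t => ω (γ.extend t) (deriv γ.extend t)) volume := by
  obtain ⟨C, hC⟩ := exists_norm_form1_le ω
  refine ((integrable_deriv_extend (γ := γ)).norm.const_mul C).mono' ?_ (ae_of_all _ fun t => ?_)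
  · exact (isBoundedBilinearMap_apply.continuous).comp_aestronglyMeasurable
      ((ω.continuous.comp γ.continuous_extend).aestronglyMeasurable.prodMk
        integrable_deriv_extend.aestronglyMeasurable)
  · exact (ContinuousLinearMap.le_opNorm _ _).trans (by gcongr; exact hC _)

theorem integrable_form0_extend (χ : Form0 m) :
    Integrable (fun t => χ (γ.extend t) * ‖deriv γ.extend t‖) volume := by
  obtain ⟨C, hC⟩ := χ.continuous.bounded_above_of_compact_support χ.hasCompactSupport
  refine ((integrable_deriv_extend (γ := γ)).norm.const_mul C).mono' ?_ (ae_of_all _ fun t => ?_)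
  · exact (χ.continuous.comp γ.continuous_extend).aestronglyMeasurable.mul
        integrable_deriv_extend.norm.aestronglyMeasurable
  · rw [norm_mul, norm_norm]
    gcongr
    exact hC _

theorem IsSimple.abs_current_le (h : γ.IsSimple) (hn : γ.IsNonconstant) (ω : Form1 m) :
    |γ.current ω| ≤ ∫ x, ‖ω x‖ ∂γ.lengthMeasure := by
  rw [h.current_eq hn, integral_lengthMeasure ω.continuous.norm]
  obtain ⟨C, hC⟩ := exists_norm_form1_le ω
  refine norm_integral_le_of_norm_le ?_
    (ae_of_all _ fun t => (ω (γ.extend t)).le_opNorm (deriv γ.extend t))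
  refine ((integrable_deriv_extend (γ := γ)).norm.const_mul C).mono' ?_ (ae_of_all _ fun t => ?_)
  · exact (ω.continuous.comp γ.continuous_extend).norm.aestronglyMeasurable.mul
        integrable_deriv_extend.norm.aestronglyMeasurable
  · rw [norm_mul, norm_norm, norm_norm]
    gcongr
    exact hC _

/-- If `ω` nearly calibrates a simple curve, that is, if its integral along the curve is nearly the
length, then `ω` localizes the length measure: `χ ω` nearly computes `∫ χ` along the curve. -/
theorem IsSimple.abs_integral_sub_current_mulForm_le (h : γ.IsSimple) (hn : γ.IsNonconstant)
    (χ : Form0 m) (hχ : ∀ x, |χ x| ≤ 1) (ω : Form1 m) (hω : ∀ x, ‖ω x‖ ≤ 1) :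
    |(∫ x, χ x ∂γ.lengthMeasure) - γ.current (mulForm χ ω)| ≤
      γ.lengthMeasure.real univ - γ.current ω := by
  have h1 : γ.lengthMeasure.real univ = ∫ t, ‖deriv γ.extend t‖ := by
    have := integral_lengthMeasure (γ := γ) (h := fun _ => 1) continuous_const
    simpa using this
  rw [h1, h.current_eq hn, h.current_eq hn, integral_lengthMeasure χ.continuous,
    ← integral_sub (integrable_form0_extend χ) (integrable_form1_extend _),
    ← integral_sub integrable_deriv_extend.norm (integrable_form1_extend ω)]
  rw [← Real.norm_eq_abs]
  refine norm_integral_le_of_norm_le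
    (integrable_deriv_extend.norm.sub (integrable_form1_extend ω)) (ae_of_all _ fun t => ?_)
  have h2 : ω (γ.extend t) (deriv γ.extend t) ≤ ‖deriv γ.extend t‖ := by
    refine (le_abs_self _).trans (((ω (γ.extend t)).le_opNorm _).trans ?_)
    exact mul_le_of_le_one_left (norm_nonneg _) (hω _)
  have h3 : χ (γ.extend t) * ‖deriv γ.extend t‖
      - mulForm χ ω (γ.extend t) (deriv γ.extend t) =
      χ (γ.extend t) * (‖deriv γ.extend t‖ - ω (γ.extend t) (deriv γ.extend t)) := by
    simp [mul_sub]
  rw [h3, Real.norm_eq_abs, abs_mul, abs_of_nonneg (sub_nonneg.2 h2)]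
  exact mul_le_of_le_one_left (sub_nonneg.2 h2) (hχ _)

theorem IsSimple.enorm_current_le (h : γ.IsSimple) (hn : γ.IsNonconstant) {ω : Form1 m} {C : ℝ≥0}
    (hω : ∀ x, ‖ω x‖ ≤ C) : ‖γ.current ω‖ₑ ≤ C * γ.lengthMeasure univ := by
  have h1 : |γ.current ω| ≤ C * γ.lengthMeasure.real univ := by
    refine (h.abs_current_le hn ω).trans ?_
    calc ∫ x, ‖ω x‖ ∂γ.lengthMeasure ≤ ∫ x, (C : ℝ) ∂γ.lengthMeasure :=
          integral_mono (integrable_norm_form1 ω _) (integrable_const _) hω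
      _ = C * γ.lengthMeasure.real univ := by simp [mul_comm]
  rw [← Real.norm_eq_abs] at h1
  rw [← ofReal_norm, ← ENNReal.ofReal_coe_nnreal, ← ofReal_measureReal,
    ← ENNReal.ofReal_mul C.coe_nonneg]
  exact ENNReal.ofReal_le_ofReal h1

theorem IsSimple.mass_current_le (h : γ.IsSimple) (hn : γ.IsNonconstant) :
    mass γ.current ≤ γ.lengthMeasure univ := by
  refine iSup₂_le fun ω hω => (Real.ofReal_le_enorm _).trans ?_
  simpa using h.enorm_current_le hn (C := 1) (by simpa using hω)

/-- The boundary of a non-constant simple curve has mass two. -/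
theorem IsSimple.mass_boundary_current (h : γ.IsSimple) (hn : γ.IsNonconstant) :
    mass (boundary γ.current) = 2 := by
  apply le_antisymm
  · refine iSup₂_le fun f hf => ?_
    rw [h.boundary_current hn]
    have h1 := abs_le.1 (hf γ.endPt)
    have h2 := abs_le.1 (hf γ.startPt)
    calc ENNReal.ofReal (f γ.endPt - f γ.startPt) ≤ ENNReal.ofReal 2 :=
          ENNReal.ofReal_le_ofReal (by linarith [h1.2, h2.1])
      _ = 2 := by simp
  · have hne := h.startPt_ne_endPt hn
    obtain ⟨U, V, hU, hV, hsU, heV, hUV⟩ := t2_separation hne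
    obtain ⟨f, hf0, hf1, hf, hf'⟩ := exists_form0_one_on_compact
      (isCompact_singleton (x := γ.startPt)) hU (singleton_subset_iff.2 hsU)
    obtain ⟨g, hg0, hg1, hg, hg'⟩ := exists_form0_one_on_compact
      (isCompact_singleton (x := γ.endPt)) hV (singleton_subset_iff.2 heV)
    refine le_trans ?_ (le_iSup₂ (g - f) fun x => ?_)
    · rw [h.boundary_current hn]
      have e1 := hf' _ (disjoint_right.1 hUV heV)
      have e2 := hg' _ (disjoint_left.1 hUV hsU)
      have e3 := hf _ rfl
      have e4 := hg _ rfl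
      have : (g - f) γ.endPt - (g - f) γ.startPt = 2 := by
        simp only [sub_apply, e1, e2, e3, e4]; norm_num
      rw [this]; simp
    · rw [sub_apply, Real.norm_eq_abs, abs_le]
      constructor <;> linarith [hf0 x, hf1 x, hg0 x, hg1 x]

end LipCurve

end TransportPath

/-! ### The total length measure of a family of curves -/

namespace TransportPath

variable {m : ℕ}

/-- The length measure of a family of curves: the superposition of their length measures. -/
noncomputable def totalLength (ν : Measure (LipCurve m)) : Measure (E m) :=
  ν.bind LipCurve.lengthMeasure

theorem totalLength_apply (ν : Measure (LipCurve m)) {A : Set (E m)} (hA : MeasurableSet A) :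
    totalLength ν A = ∫⁻ γ, γ.lengthMeasure A ∂ν :=
  Measure.bind_apply hA LipCurve.measurable_lengthMeasure.aemeasurable

theorem totalLength_mono {ν ν' : Measure (LipCurve m)} (h : ν ≤ ν') :
    totalLength ν ≤ totalLength ν' := by
  refine Measure.le_iff.2 fun A hA => ?_
  rw [totalLength_apply _ hA, totalLength_apply _ hA]
  exact lintegral_mono' h le_rfl

/-- The length measures of the curves, as a kernel. -/
noncomputable def lengthKernel (m : ℕ) : ProbabilityTheory.Kernel (LipCurve m) (E m) :=
  ⟨LipCurve.lengthMeasure, LipCurve.measurable_lengthMeasure⟩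

theorem integrable_lengthMeasure_real {ν : Measure (LipCurve m)} [IsFiniteMeasure (totalLength ν)] :
    Integrable (fun γ : LipCurve m => γ.lengthMeasure.real univ) ν := by
  refine integrable_toReal_of_lintegral_ne_top
    ((Measure.measurable_coe MeasurableSet.univ).comp
      LipCurve.measurable_lengthMeasure).aemeasurable ?_
  rw [← totalLength_apply _ MeasurableSet.univ]
  exact measure_ne_top _ _

theorem integral_lengthMeasure_real {ν : Measure (LipCurve m)} :
    ∫ γ : LipCurve m, γ.lengthMeasure.real univ ∂ν = (totalLength ν univ).toReal := by
  rw [totalLength_apply _ MeasurableSet.univ]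
  exact integral_toReal ((Measure.measurable_coe MeasurableSet.univ).comp
      LipCurve.measurable_lengthMeasure).aemeasurable
    (ae_of_all _ fun γ => measure_lt_top _ _)

theorem totalLength_eq_comp (ν : Measure (LipCurve m)) : totalLength ν =
    ((lengthKernel m).comp (ProbabilityTheory.Kernel.const Unit ν)) () := by
  rw [ProbabilityTheory.Kernel.comp_apply, ProbabilityTheory.Kernel.const_apply]
  rfl

theorem integral_totalLength {ν : Measure (LipCurve m)} {f : E m → ℝ}
    (hf : Integrable f (totalLength ν)) :
    ∫ x, f x ∂totalLength ν = ∫ γ, ∫ x, f x ∂γ.lengthMeasure ∂ν := by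
  rw [totalLength_eq_comp] at hf ⊢
  rw [ProbabilityTheory.Kernel.integral_comp hf, ProbabilityTheory.Kernel.const_apply]
  rfl

theorem integrable_integral_lengthMeasure {ν : Measure (LipCurve m)} {f : E m → ℝ}
    (hf : Integrable f (totalLength ν)) :
    Integrable (fun γ : LipCurve m => ∫ x, f x ∂γ.lengthMeasure) ν := by
  rw [totalLength_eq_comp] at hf
  have := hf.integral_comp
  rwa [ProbabilityTheory.Kernel.const_apply] at this

/-! ### Masses -/

section Mass

variable {F : Type} [NormedAddCommGroup F] [NormedSpace ℝ F]

theorem ofReal_le_mass {T : TestFunction (⊤ : TopologicalSpace.Opens (E m)) F (⊤ : ℕ∞) → ℝ}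
    {ω : TestFunction (⊤ : TopologicalSpace.Opens (E m)) F (⊤ : ℕ∞)} (hω : ∀ x, ‖ω x‖ ≤ 1) :
    ENNReal.ofReal (T ω) ≤ mass T :=
  le_iSup₂ (f := fun (ω : TestFunction (⊤ : TopologicalSpace.Opens (E m)) F (⊤ : ℕ∞))
    (_ : ∀ x, ‖ω x‖ ≤ 1) => ENNReal.ofReal (T ω)) ω hω

theorem exists_form_near_mass
    {T : TestFunction (⊤ : TopologicalSpace.Opens (E m)) F (⊤ : ℕ∞) → ℝ} (h0 : T 0 = 0)
    {ε : ℝ} (hε : 0 < ε) :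
    ∃ ω : TestFunction (⊤ : TopologicalSpace.Opens (E m)) F (⊤ : ℕ∞),
      (∀ x, ‖ω x‖ ≤ 1) ∧ (mass T).toReal - ε ≤ T ω := by
  by_contra! hcon
  have h1 : mass T ≤ ENNReal.ofReal ((mass T).toReal - ε) :=
    iSup₂_le fun ω hω => ENNReal.ofReal_le_ofReal (hcon ω hω).le
  have h2 := hcon 0 (by simp)
  rw [h0] at h2
  have h3 := ENNReal.toReal_mono ENNReal.ofReal_ne_top h1
  rw [ENNReal.toReal_ofReal h2.le] at h3
  linarith

/-- The mass of a superposition is at most the superposition of the masses. -/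
theorem mass_le_lintegral_mass {α : Type*} [MeasurableSpace α] {ν : Measure α}
    {T : TestFunction (⊤ : TopologicalSpace.Opens (E m)) F (⊤ : ℕ∞) → ℝ}
    {S : α → TestFunction (⊤ : TopologicalSpace.Opens (E m)) F (⊤ : ℕ∞) → ℝ}
    (h : ∀ ω, T ω = ∫ a, S a ω ∂ν) (hi : ∀ ω, Integrable (fun a => S a ω) ν) :
    mass T ≤ ∫⁻ a, mass (S a) ∂ν := by
  refine iSup₂_le fun ω hω => ?_
  rw [h ω]
  calc ENNReal.ofReal (∫ a, S a ω ∂ν) ≤ ∫⁻ a, ENNReal.ofReal (S a ω) ∂ν := by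
        refine ENNReal.ofReal_le_of_le_toReal ?_
        rw [integral_eq_lintegral_pos_part_sub_lintegral_neg_part (hi ω)]
        exact sub_le_self _ ENNReal.toReal_nonneg
    _ ≤ _ := lintegral_mono fun a => ofReal_le_mass hω

end Mass

/-! ### Consequences of the mass identities of a good decomposition -/

namespace IsGoodDecomposition

variable {η : Measure (LipCurve m)} {T : Current1 m}

theorem mass_ne_top (h : IsGoodDecomposition η T) : mass (T : Form1 m → ℝ) ≠ ∞ :=
  ((le_add_right le_rfl).trans_lt h.normal).ne

theorem mass_eq_totalLength (h : IsGoodDecomposition η T) :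
    mass (T : Form1 m → ℝ) = totalLength η univ := by
  rw [h.mass_eq, h.mass_eq_length, totalLength_apply _ MeasurableSet.univ]
  refine lintegral_congr_ae ?_
  filter_upwards [h.supported] with γ hγ
  rw [← hγ.2.hausdorffMeasure_restrict_range hγ.1, Measure.restrict_apply_univ]

theorem isFiniteMeasure_totalLength (h : IsGoodDecomposition η T) :
    IsFiniteMeasure (totalLength η) :=
  ⟨by rw [← h.mass_eq_totalLength]; exact h.mass_ne_top.lt_top⟩

theorem isFiniteMeasure_totalLength_restrict (h : IsGoodDecomposition η T)
    (G : Set (LipCurve m)) : IsFiniteMeasure (totalLength (η.restrict G)) := by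
  have := h.isFiniteMeasure_totalLength
  exact isFiniteMeasure_of_le _ (totalLength_mono Measure.restrict_le_self)

/-- There is no cancellation of mass in a good decomposition: a form which nearly calibrates `T`
nearly calibrates the curves of the decomposition on average, and so, after multiplication by a
function `χ`, computes the integral of `χ` along the curves of any subfamily. -/
theorem exists_form_near (h : IsGoodDecomposition η T) {ε : ℝ} (hε : 0 < ε) :
    ∃ ω : Form1 m, (∀ x, ‖ω x‖ ≤ 1) ∧ ∀ χ : Form0 m, (∀ x, |χ x| ≤ 1) →
      ∀ G : Set (LipCurve m),
        |(∫ x, χ x ∂totalLength (η.restrict G)) - ∫ γ in G, γ.current (mulForm χ ω) ∂η| ≤ ε := by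
  obtain ⟨ω, hω, hω'⟩ := exists_form_near_mass (T := (T : Form1 m → ℝ)) (map_zero T) hε
  refine ⟨ω, hω, fun χ hχ G => ?_⟩
  have := h.isFiniteMeasure_totalLength
  have := h.isFiniteMeasure_totalLength_restrict G
  have hb : ∀ᵐ γ ∂η, |(∫ x, χ x ∂γ.lengthMeasure) - γ.current (mulForm χ ω)| ≤
      γ.lengthMeasure.real univ - γ.current ω := by
    filter_upwards [h.supported] with γ hγ
    exact hγ.2.abs_integral_sub_current_mulForm_le hγ.1 χ hχ ω hω
  have hi : Integrable (fun γ : LipCurve m => γ.lengthMeasure.real univ - γ.current ω) η :=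
    integrable_lengthMeasure_real.sub (h.integrable ω)
  have hχi := integrable_form0 χ (totalLength (η.restrict G))
  rw [integral_totalLength hχi, ← integral_sub (integrable_integral_lengthMeasure hχi)
    (h.integrable _).restrict]
  calc |∫ γ in G, ((∫ x, χ x ∂γ.lengthMeasure) - γ.current (mulForm χ ω)) ∂η|
      ≤ ∫ γ in G, (γ.lengthMeasure.real univ - γ.current ω) ∂η := by
        rw [← Real.norm_eq_abs]
        exact norm_integral_le_of_norm_le hi.restrict (ae_restrict_of_ae hb)
    _ ≤ ∫ γ, (γ.lengthMeasure.real univ - γ.current ω) ∂η :=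
        setIntegral_le_integral hi (hb.mono fun γ hγ => (abs_nonneg _).trans hγ)
    _ = (mass (T : Form1 m → ℝ)).toReal - T ω := by
        rw [integral_sub integrable_lengthMeasure_real (h.integrable ω),
          integral_lengthMeasure_real, h.mass_eq_totalLength, h.repr ω]
    _ ≤ ε := by linarith

end IsGoodDecomposition

/-- A finite measure dominated by a density on a `ν`-measurable set is carried, up to `ε`, by a set
of finite `ν`-measure. -/
theorem exists_measure_lt_top_of_le_withDensity {ν Λ : Measure (E m)} {M : Set (E m)}
    {θ : E m → ℝ} (hM : NullMeasurableSet M ν) (hpos : ∀ x ∈ M, 0 < θ x)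
    (hθ : LocallyIntegrable θ (ν.restrict M)) [IsFiniteMeasure Λ]
    (hΛ : Λ ≤ (ν.restrict M).withDensity fun x => ENNReal.ofReal (θ x)) {ε : ℝ≥0∞} (hε : 0 < ε) :
    ∃ A : Set (E m), MeasurableSet A ∧ ν A < ∞ ∧ Λ Aᶜ ≤ ε := by
  obtain ⟨M₁, hM₁M, hM₁, hM₁eq⟩ := hM.exists_measurable_subset_ae_eq
  have hsm := hθ.aestronglyMeasurable
  set θ' := hsm.mk θ
  have hθ'm : Measurable θ' := hsm.stronglyMeasurable_mk.measurable
  have hθ' : θ =ᵐ[ν.restrict M] θ' := hsm.ae_eq_mk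
  -- Where the density is at least `1 / (k + 1)`, local integrability bounds the `ν`-measure.
  set A : ℕ → Set (E m) := fun k => M₁ ∩ Metric.ball 0 k ∩ {x | ((k : ℝ) + 1)⁻¹ ≤ θ' x} with hA
  have hAm : ∀ k, MeasurableSet (A k) := fun k =>
    (hM₁.inter Metric.isOpen_ball.measurableSet).inter (measurableSet_le measurable_const hθ'm)
  have hAmono : Monotone A := by
    intro k l hkl x hx
    have hkl' : (k : ℝ) ≤ l := by exact_mod_cast hkl
    refine ⟨⟨hx.1.1, Metric.ball_subset_ball hkl' hx.1.2⟩, le_trans (b := ((k : ℝ) + 1)⁻¹) ?_ hx.2⟩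
    exact inv_anti₀ (by positivity) (by linarith)
  have hfin : ∀ k, ν (A k) < ∞ := by
    intro k
    have hAM : A k ⊆ M := fun x hx => hM₁M hx.1.1
    have h1 : ν (A k) = ν.restrict M (A k) := by
      rw [Measure.restrict_apply (hAm k), inter_eq_left.2 hAM]
    have h2 : ∫⁻ x in A k, ENNReal.ofReal (θ' x) ∂(ν.restrict M) < ∞ := by
      have h3 : IntegrableOn θ (Metric.closedBall 0 k) (ν.restrict M) :=
        hθ.integrableOn_isCompact (isCompact_closedBall _ _)
      have h4 : IntegrableOn θ' (A k) (ν.restrict M) :=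
        (h3.mono_set fun x hx => Metric.ball_subset_closedBall hx.1.2).congr
          (ae_restrict_of_ae hθ')
      refine lt_of_le_of_lt (lintegral_mono fun x => ?_) h4.2
      exact Real.ofReal_le_enorm _
    have h3 : ENNReal.ofReal ((k : ℝ) + 1)⁻¹ * ν.restrict M (A k) < ∞ := by
      refine lt_of_le_of_lt ?_ h2
      rw [← setLIntegral_const]
      exact setLIntegral_mono' (hAm k) fun x hx => ENNReal.ofReal_le_ofReal hx.2
    rw [h1]
    exact ENNReal.lt_top_of_mul_ne_top_right h3.ne
      (by simpa using (by positivity : (0 : ℝ) < (k : ℝ) + 1))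
  have hnull : Λ (⋂ k, (A k)ᶜ) = 0 := by
    refine le_antisymm ((hΛ _).trans ?_) zero_le
    refine (withDensity_absolutelyContinuous (ν.restrict M) _ ?_).le
    have hae : ∀ᵐ x ∂(ν.restrict M), x ∈ M₁ := by
      rw [← Measure.restrict_congr_set hM₁eq]
      exact ae_restrict_mem hM₁
    refine measure_mono_null ?_ (ae_iff.1 (hae.and hθ'))
    rintro x hx ⟨hx1, hx2⟩
    obtain ⟨k, hk⟩ := exists_nat_gt (‖x‖)
    have hp : 0 < θ' x := hx2 ▸ hpos x (hM₁M hx1)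
    obtain ⟨l, hl⟩ := exists_nat_one_div_lt hp
    refine (mem_iInter.1 hx (max k l)) ⟨⟨hx1, ?_⟩, ?_⟩
    · rw [mem_ball_zero_iff]
      exact hk.trans_le (by exact_mod_cast le_max_left k l)
    · refine le_trans ?_ hl.le
      rw [one_div]
      refine inv_anti₀ (by positivity) ?_
      have : (l : ℝ) ≤ (max k l : ℕ) := by exact_mod_cast le_max_right k l
      linarith
  have hlim : Tendsto (fun k => Λ (A k)ᶜ) atTop (𝓝 0) := by
    rw [← hnull]
    exact tendsto_measure_iInter_atTop (fun k => (hAm k).compl.nullMeasurableSet)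
      (fun k l hkl => compl_subset_compl.2 (hAmono hkl)) ⟨0, measure_ne_top _ _⟩
  obtain ⟨k, hk⟩ := (hlim.eventually_le_const hε).exists
  exact ⟨A k, hAm k, hfin k, hk⟩

namespace IsGoodDecomposition

variable {η : Measure (LipCurve m)} {T : Current1 m}

/-- The length measure of a good decomposition of a rectifiable current is carried, up to `ε`, by a
set of finite length: it is dominated by the measure `θ ℋ¹⌊M` of the current. -/
theorem exists_hausdorffMeasure_lt_top (h : IsGoodDecomposition η T) (hT : IsRectifiable T)
    {ε : ℝ≥0∞} (hε : 0 < ε) :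
    ∃ A : Set (E m), MeasurableSet A ∧ μH[1] A < ∞ ∧ totalLength η Aᶜ ≤ ε := by
  obtain ⟨M, θ, ξ, hM, -, hpos, hθ, -, hξ, hrepr⟩ := hT
  have := h.isFiniteMeasure_totalLength
  refine exists_measure_lt_top_of_le_withDensity hM hpos hθ ?_ hε
  have hθm : AEMeasurable (fun x => ENNReal.ofReal (θ x)) (μH[1].restrict M) :=
    hθ.aestronglyMeasurable.aemeasurable.ennreal_ofReal
  have hθpos : ∀ᵐ x ∂(μH[1].restrict M), 0 < θ x :=
    (ae_restrict_mem₀ hM).mono fun x hx => hpos x hx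
  have : IsLocallyFiniteMeasure
      ((μH[1].restrict M).withDensity fun x => ENNReal.ofReal (θ x)) := by
    refine ⟨fun x => ?_⟩
    obtain ⟨U, hU, hUi⟩ := hθ x
    obtain ⟨V, hVU, hV, hxV⟩ := mem_nhds_iff.1 hU
    refine ⟨V, hV.mem_nhds hxV, ?_⟩
    rw [withDensity_apply _ hV.measurableSet]
    exact lt_of_le_of_lt (lintegral_mono fun x => Real.ofReal_le_enorm _) (hUi.mono_set hVU).2
  refine measure_le_of_forall_form0 fun χ h0 h1 => ?_
  have habs : ∀ x, |χ x| ≤ 1 := fun x => by rw [abs_of_nonneg (h0 x)]; exact h1 x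
  have hχθ : Integrable (fun x => χ x * θ x) (μH[1].restrict M) :=
    hθ.integrable_smul_left_of_hasCompactSupport χ.continuous χ.hasCompactSupport
  have hχθ0 : 0 ≤ᵐ[μH[1].restrict M] fun x => χ x * θ x :=
    hθpos.mono fun x hx => mul_nonneg (h0 x) hx.le
  have hr : ∫⁻ x, ENNReal.ofReal (χ x)
      ∂((μH[1].restrict M).withDensity fun x => ENNReal.ofReal (θ x)) =
      ENNReal.ofReal (∫ x in M, χ x * θ x ∂μH[1]) := by
    rw [lintegral_withDensity_eq_lintegral_mul₀ hθm
      χ.continuous.measurable.ennreal_ofReal.aemeasurable,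
      ofReal_integral_eq_lintegral_ofReal hχθ hχθ0]
    refine lintegral_congr fun x => ?_
    rw [Pi.mul_apply, mul_comm, ENNReal.ofReal_mul (h0 x)]
  rw [hr, ← ofReal_integral_eq_lintegral_ofReal (integrable_form0 χ _) (ae_of_all _ h0)]
  refine ENNReal.ofReal_le_ofReal (le_of_forall_pos_le_add fun δ hδ => ?_)
  obtain ⟨ω, hω, hω'⟩ := h.exists_form_near hδ
  have h2 := hω' χ habs univ
  rw [Measure.restrict_univ, ← h.repr] at h2
  have h3 : T (mulForm χ ω) ≤ ∫ x in M, χ x * θ x ∂μH[1] := by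
    rw [hrepr]
    by_cases hi : Integrable (fun x => mulForm χ ω x (ξ x) * θ x) (μH[1].restrict M)
    · refine integral_mono_ae hi hχθ ?_
      filter_upwards [hξ, hθpos] with x hx hx'
      have h4 : ω x (ξ x) ≤ 1 := by
        refine (le_abs_self _).trans (((ω x).le_opNorm _).trans ?_)
        rw [hx.1, mul_one]
        exact hω x
      simp only [mulForm_apply, smul_apply, smul_eq_mul]
      have := mul_le_of_le_one_right (h0 x) h4
      gcongr
    · rw [integral_undef hi]
      exact integral_nonneg_of_ae hχθ0
  linarith [(abs_le.1 h2).2]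

/-! ### The endpoints of the curves of a good decomposition -/

theorem integral_endpoints (h : IsGoodDecomposition η T) (f : Form0 m) :
    boundary (T : Form1 m → ℝ) f =
      (∫ x, f x ∂η.map LipCurve.endPt) - ∫ x, f x ∂η.map LipCurve.startPt := by
  have := h.finite
  have he : Integrable (fun γ : LipCurve m => f γ.endPt) η :=
    (integrable_form0 f (η.map LipCurve.endPt)).comp_measurable LipCurve.measurable_endPt
  have hs : Integrable (fun γ : LipCurve m => f γ.startPt) η :=
    (integrable_form0 f (η.map LipCurve.startPt)).comp_measurable
      LipCurve.continuous_startPt.measurable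
  rw [integral_map LipCurve.measurable_endPt.aemeasurable f.continuous.aestronglyMeasurable,
    integral_map LipCurve.continuous_startPt.measurable.aemeasurable
      f.continuous.aestronglyMeasurable, ← integral_sub he hs, boundary, h.repr]
  refine integral_congr_ae ?_
  filter_upwards [h.supported] with γ hγ
  exact hγ.2.boundary_current hγ.1 f

/-- The initial and final marginals of a good decomposition are mutually singular, since there is
no cancellation in the mass of the boundary. -/
theorem eq_zero_of_le_marginals (h : IsGoodDecomposition η T) {r : Measure (E m)}
    (hs : r ≤ η.map LipCurve.startPt) (he : r ≤ η.map LipCurve.endPt) : r = 0 := by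
  have := h.finite
  have : IsFiniteMeasure r := isFiniteMeasure_of_le _ hs
  set p := η.map LipCurve.startPt - r
  set q := η.map LipCurve.endPt - r
  have hp : p + r = η.map LipCurve.startPt := Measure.sub_add_cancel_of_le hs
  have hq : q + r = η.map LipCurve.endPt := Measure.sub_add_cancel_of_le he
  have : IsFiniteMeasure p := isFiniteMeasure_of_le _ (Measure.le_add_right le_rfl |>.trans_eq hp)
  have : IsFiniteMeasure q := isFiniteMeasure_of_le _ (Measure.le_add_right le_rfl |>.trans_eq hq)
  have hpu : p univ + r univ = η univ := by
    rw [← Measure.add_apply, hp, Measure.map_apply LipCurve.continuous_startPt.measurable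
      MeasurableSet.univ, preimage_univ]
  have hqu : q univ + r univ = η univ := by
    rw [← Measure.add_apply, hq, Measure.map_apply LipCurve.measurable_endPt
      MeasurableSet.univ, preimage_univ]
  have hmass : mass (boundary (T : Form1 m → ℝ)) ≤ p univ + q univ := by
    refine iSup₂_le fun f hf => ?_
    have hb : ∀ (ν : Measure (E m)) [IsFiniteMeasure ν], |∫ x, f x ∂ν| ≤ ν.real univ := by
      intro ν _
      have := norm_integral_le_of_norm_le_const (μ := ν) (ae_of_all _ hf)
      simpa using this
    rw [h.integral_endpoints, ← hp, ← hq, integral_add_measure (integrable_form0 f _)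
      (integrable_form0 f _), integral_add_measure (integrable_form0 f _) (integrable_form0 f _)]
    have h1 := (abs_le.1 (hb q)).2
    have h2 := (abs_le.1 (hb p)).1
    refine ENNReal.ofReal_le_of_le_toReal ?_
    rw [ENNReal.toReal_add (measure_ne_top _ _) (measure_ne_top _ _)]
    simp only [Measure.real] at h1 h2
    linarith
  rw [h.mass_boundary_eq, h.mass_boundary_eq_two] at hmass
  have hfin : p univ + q univ ≠ ∞ := by finiteness
  have h3 : p univ + q univ + 2 * r univ ≤ p univ + q univ := by
    calc p univ + q univ + 2 * r univ = (p univ + r univ) + (q univ + r univ) := by ring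
      _ = 2 * η univ := by rw [hpu, hqu, two_mul]
      _ ≤ _ := hmass
  have h4 : 2 * r univ = 0 := by
    refine le_antisymm ?_ zero_le
    exact (ENNReal.add_le_add_iff_left hfin).1 (by simpa using h3)
  exact Measure.measure_univ_eq_zero.1 (by simpa using h4)

end IsGoodDecomposition

end TransportPath

/-! ### Extremal redistributions of weights -/

namespace TransportPath

/-- A family of weights `c (i, j)` on currents `S · (i, j)`, together with length measures
`Λ (i, j)` controlling these currents, whose weighted sum is at most a finite measure `total`.
The last two fields say that the `Λ (i, j)` are bounded by a fixed measure `ρ`, and that `total` is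
carried by a set of finite `ρ`-measure up to `ε`; they prevent a loss of mass in limits. -/
structure WeightedFamily (I J X Ω : Type*) [MeasurableSpace X] where
  /-- the weights -/
  c : I × J → ℝ
  /-- the length measures -/
  Λ : I × J → Measure X
  /-- a bound for the weighted sum of the length measures -/
  total : Measure X
  /-- the values of the currents -/
  S : Ω → I × J → ℝ
  /-- a bound for the test forms -/
  bound : Ω → ℝ≥0
  /-- the reference measure -/
  ρ : Measure X
  nonneg : ∀ p, 0 ≤ c p
  summable : Summable c
  isFiniteMeasure_total : IsFiniteMeasure total
  isFiniteMeasure_Λ : ∀ p, IsFiniteMeasure (Λ p)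
  tsum_le : ∀ A, MeasurableSet A → ∑' p, ENNReal.ofReal (c p) * Λ p A ≤ total A
  enorm_S_le : ∀ ω p, ‖S ω p‖ₑ ≤ bound ω * Λ p univ
  Λ_le : ∀ p, Λ p ≤ ρ
  exists_measure_lt_top : ∀ ε : ℝ≥0∞, 0 < ε →
    ∃ A, MeasurableSet A ∧ ρ A < ∞ ∧ total Aᶜ ≤ ε

namespace WeightedFamily

variable {I J X Ω : Type*} [MeasurableSpace X] (D : WeightedFamily I J X Ω)

/-- The row sums of the weights. -/
noncomputable def row (i : I) : ℝ := ∑' j, D.c (i, j)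

/-- The column sums of the weights. -/
noncomputable def col (j : J) : ℝ := ∑' i, D.c (i, j)

theorem summable_row : Summable D.row := D.summable.prod

theorem summable_swap : Summable fun q : J × I => D.c q.swap :=
  (Equiv.prodComm J I).summable_iff.2 D.summable

theorem summable_col : Summable D.col := D.summable_swap.prod

theorem le_row (p : I × J) : D.c p ≤ D.row p.1 :=
  (D.summable.prod_factor p.1).le_tsum p.2 fun _ _ => D.nonneg _

theorem le_col (p : I × J) : D.c p ≤ D.col p.2 :=
  (D.summable_swap.prod_factor p.2).le_tsum p.1 fun _ _ => D.nonneg _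

/-- Nonnegative weights, bounded by the row and column sums of the given ones, which vanish where
the given ones do. -/
def bounded : Set (I × J → ℝ) :=
  {w | ∀ p, 0 ≤ w p ∧ w p ≤ D.row p.1 ∧ w p ≤ D.col p.2 ∧ (D.c p = 0 → w p = 0)}

/-- Bounded weights with the given row and column sums, whose length measures add up to at most the
total length measure. -/
def admissible : Set (I × J → ℝ) :=
  {w ∈ D.bounded | (∀ i, ∑' j, w (i, j) = D.row i) ∧ (∀ j, ∑' i, w (i, j) = D.col j) ∧
    ∀ A, MeasurableSet A → ∑' p, ENNReal.ofReal (w p) * D.Λ p A ≤ D.total A}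

/-- The admissible weights which give the same superposition of the currents as the given ones. -/
def competitors : Set (I × J → ℝ) :=
  {w ∈ D.admissible | ∀ ω, ∑' p, w p * D.S ω p = ∑' p, D.c p * D.S ω p}

variable {D} {w : I × J → ℝ}

theorem c_mem_competitors : D.c ∈ D.competitors :=
  ⟨⟨fun p => ⟨D.nonneg p, D.le_row p, D.le_col p, id⟩, fun _ => rfl, fun _ => rfl, D.tsum_le⟩,
    fun _ => rfl⟩

theorem summable_row_of_mem (hw : w ∈ D.bounded) (i : I) : Summable fun j => w (i, j) :=
  .of_nonneg_of_le (fun j => (hw (i, j)).1) (fun j => (hw (i, j)).2.2.1) D.summable_col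

theorem summable_col_of_mem (hw : w ∈ D.bounded) (j : J) : Summable fun i => w (i, j) :=
  .of_nonneg_of_le (fun i => (hw (i, j)).1) (fun i => (hw (i, j)).2.1) D.summable_row

theorem tsum_ofReal_row (hw : w ∈ D.admissible) (i : I) :
    ∑' j, ENNReal.ofReal (w (i, j)) = ENNReal.ofReal (D.row i) := by
  rw [← hw.2.1 i, ENNReal.ofReal_tsum_of_nonneg (fun j => (hw.1 (i, j)).1)
    (summable_row_of_mem hw.1 i)]

theorem tsum_ofReal_col (hw : w ∈ D.admissible) (j : J) :
    ∑' i, ENNReal.ofReal (w (i, j)) = ENNReal.ofReal (D.col j) := by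
  rw [← hw.2.2.1 j, ENNReal.ofReal_tsum_of_nonneg (fun i => (hw.1 (i, j)).1)
    (summable_col_of_mem hw.1 j)]

/-- The total weight of all but finitely many pairs is small, uniformly in the weights. -/
theorem tsum_compl_ofReal_le (hw : w ∈ D.admissible) {F₁ : Finset I} {F₂ : Finset J}
    {F : Finset (I × J)} (hF : F₁ ×ˢ F₂ ⊆ F) :
    ∑' p : {p // p ∉ F}, ENNReal.ofReal (w p) ≤
      (∑' i : {i // i ∉ F₁}, ENNReal.ofReal (D.row i)) +
        ∑' j : {j // j ∉ F₂}, ENNReal.ofReal (D.col j) := by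
  have h0 : ∑' p : {p // p ∉ F}, ENNReal.ofReal (w p) =
      ∑' p, {p | p ∉ F}.indicator (fun p => ENNReal.ofReal (w p)) p :=
    tsum_subtype {p | p ∉ F} fun p => ENNReal.ofReal (w p)
  have h1 : ∑' i : {i // i ∉ F₁}, ENNReal.ofReal (D.row i) =
      ∑' p : I × J, {i | i ∉ F₁}.indicator (fun i => ENNReal.ofReal (w (i, p.2))) p.1 := by
    rw [ENNReal.tsum_prod', show ∑' i : {i // i ∉ F₁}, ENNReal.ofReal (D.row i) = _ from
      tsum_subtype {i | i ∉ F₁} fun i => ENNReal.ofReal (D.row i)]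
    refine tsum_congr fun i => ?_
    by_cases hi : i ∈ F₁
    · simp [hi]
    · simp [hi, tsum_ofReal_row hw]
  have h2 : ∑' j : {j // j ∉ F₂}, ENNReal.ofReal (D.col j) =
      ∑' p : I × J, {j | j ∉ F₂}.indicator (fun j => ENNReal.ofReal (w (p.1, j))) p.2 := by
    rw [ENNReal.tsum_prod', ENNReal.tsum_comm,
      show ∑' j : {j // j ∉ F₂}, ENNReal.ofReal (D.col j) = _ from
      tsum_subtype {j | j ∉ F₂} fun j => ENNReal.ofReal (D.col j)]
    refine tsum_congr fun j => ?_
    by_cases hj : j ∈ F₂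
    · simp [hj]
    · simp [hj, tsum_ofReal_col hw]
  rw [h0, h1, h2, ← ENNReal.tsum_add]
  refine ENNReal.tsum_le_tsum fun p => ?_
  by_cases hp : p ∈ F
  · simp [hp]
  by_cases h₁ : p.1 ∈ F₁
  · have h₂ : p.2 ∉ F₂ := fun h₂ => hp (hF (Finset.mem_product.2 ⟨h₁, h₂⟩))
    simp [hp, h₁, h₂]
  · simp [hp, h₁]

/-- Uniform integrability of the length. On a set of finite `ρ`-measure the length of each class is
bounded, so that classes of small total weight contribute little; off this set, even the total
length is small. -/
theorem eventually_tsum_compl_le (D : WeightedFamily I J X Ω) {ε : ℝ≥0∞} (hε : 0 < ε) :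
    ∀ᶠ F : Finset (I × J) in atTop, ∀ w ∈ D.admissible,
      ∑' p : {p // p ∉ F}, ENNReal.ofReal (w p) * D.Λ p univ ≤ ε := by
  have hε2 : 0 < ε / 2 := ENNReal.half_pos hε.ne'
  obtain ⟨A, hA, hρA, hAc⟩ := D.exists_measure_lt_top (ε / 2) hε2
  obtain ⟨δ, hδ, hδ'⟩ := ENNReal.exists_pos_mul_lt hρA.ne hε2.ne'
  have hδ2 : 0 < δ / 2 := ENNReal.half_pos hδ.ne'
  have hr : ∑' i, ENNReal.ofReal (D.row i) ≠ ∞ := D.summable_row.tsum_ofReal_ne_top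
  have hc : ∑' j, ENNReal.ofReal (D.col j) ≠ ∞ := D.summable_col.tsum_ofReal_ne_top
  obtain ⟨F₁, hF₁⟩ :=
    ((ENNReal.tendsto_tsum_compl_atTop_zero hr).eventually_le_const hδ2).exists
  obtain ⟨F₂, hF₂⟩ :=
    ((ENNReal.tendsto_tsum_compl_atTop_zero hc).eventually_le_const hδ2).exists
  filter_upwards [eventually_ge_atTop (F₁ ×ˢ F₂)] with F hF w hw
  have h1 : ∀ p : {p // p ∉ F}, ENNReal.ofReal (w p) * D.Λ p univ ≤
      ENNReal.ofReal (w p) * D.ρ A + ENNReal.ofReal (w p) * D.Λ p Aᶜ := by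
    intro p
    rw [← mul_add, ← measure_add_measure_compl hA]
    gcongr
    exact D.Λ_le p
  calc ∑' p : {p // p ∉ F}, ENNReal.ofReal (w p) * D.Λ p univ
      ≤ ∑' p : {p // p ∉ F},
          (ENNReal.ofReal (w p) * D.ρ A + ENNReal.ofReal (w p) * D.Λ p Aᶜ) :=
        ENNReal.tsum_le_tsum h1
    _ = (∑' p : {p // p ∉ F}, ENNReal.ofReal (w p)) * D.ρ A +
          ∑' p : {p // p ∉ F}, ENNReal.ofReal (w p) * D.Λ p Aᶜ := by
        rw [ENNReal.tsum_add, ENNReal.tsum_mul_right]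
    _ ≤ (δ / 2 + δ / 2) * D.ρ A + ε / 2 := by
        gcongr
        · exact (tsum_compl_ofReal_le hw hF).trans (add_le_add hF₁ hF₂)
        · refine le_trans ?_ ((hw.2.2.2 _ hA.compl).trans hAc)
          exact ENNReal.tsum_comp_le_tsum_of_injective Subtype.val_injective
            fun p => ENNReal.ofReal (w p) * D.Λ p Aᶜ
    _ ≤ ε / 2 + ε / 2 := by
        rw [ENNReal.add_halves]
        gcongr
    _ = ε := ENNReal.add_halves ε

theorem enorm_mul_S_le (hw : w ∈ D.admissible) (ω : Ω) (p : I × J) :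
    ‖w p * D.S ω p‖ₑ ≤ D.bound ω * (ENNReal.ofReal (w p) * D.Λ p univ) := by
  rw [enorm_mul, Real.enorm_of_nonneg (hw.1 p).1, mul_left_comm]
  gcongr
  exact D.enorm_S_le ω p

theorem summable_mul_S (hw : w ∈ D.admissible) (ω : Ω) : Summable fun p => w p * D.S ω p := by
  have := D.isFiniteMeasure_total
  refine Summable.of_norm (tsum_enorm_ne_top_iff_summable_norm.1 (ne_top_of_le_ne_top ?_
    (ENNReal.tsum_le_tsum (enorm_mul_S_le hw ω))))
  rw [ENNReal.tsum_mul_left]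
  exact ENNReal.mul_ne_top ENNReal.coe_ne_top
    (ne_top_of_le_ne_top (measure_ne_top _ _) (hw.2.2.2 _ MeasurableSet.univ))

theorem continuousOn_tsum_mul_S (D : WeightedFamily I J X Ω) (ω : Ω) :
    ContinuousOn (fun w : I × J → ℝ => ∑' p, w p * D.S ω p) D.admissible := by
  have hu : TendstoUniformlyOn (fun (F : Finset (I × J)) (w : I × J → ℝ) => ∑ p ∈ F, w p * D.S ω p)
      (fun w => ∑' p, w p * D.S ω p) atTop D.admissible := by
    rw [EMetric.tendstoUniformlyOn_iff]
    intro ε hε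
    obtain ⟨δ, hδ, hδ'⟩ := ENNReal.exists_pos_mul_lt (ENNReal.coe_ne_top (r := D.bound ω)) hε.ne'
    filter_upwards [D.eventually_tsum_compl_le hδ] with F hF w hw
    rw [edist_eq_enorm_sub, ← (summable_mul_S hw ω).sum_add_tsum_subtype_compl F,
      add_sub_cancel_left]
    calc ‖∑' p : {p // p ∉ F}, w p * D.S ω p‖ₑ
        ≤ ∑' p : {p // p ∉ F}, ‖w p * D.S ω p‖ₑ := enorm_tsum_le_tsum_enorm
      _ ≤ ∑' p : {p // p ∉ F}, D.bound ω * (ENNReal.ofReal (w p) * D.Λ p univ) :=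
          ENNReal.tsum_le_tsum fun p => enorm_mul_S_le hw ω p
      _ ≤ D.bound ω * δ := by
          rw [ENNReal.tsum_mul_left]
          gcongr
          exact hF w hw
      _ < ε := by rwa [mul_comm]
  refine hu.continuousOn (Frequently.of_forall fun F => ?_)
  fun_prop

theorem isClosed_bounded (D : WeightedFamily I J X Ω) : IsClosed D.bounded := by
  simp only [bounded, ofPred_forall, ofPred_and]
  refine isClosed_iInter fun p => ?_
  have hc : Continuous fun w : I × J → ℝ => w p := continuous_apply p
  exact (isClosed_le continuous_const hc).inter ((isClosed_le hc continuous_const).inter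
    ((isClosed_le hc continuous_const).inter
      (isClosed_iInter fun _ => isClosed_eq hc continuous_const)))

theorem isClosed_admissible (D : WeightedFamily I J X Ω) : IsClosed D.admissible := by
  have hrow : ∀ i, IsClosed (D.bounded ∩ {w | ∑' j, w (i, j) = D.row i}) := by
    intro i
    refine ContinuousOn.preimage_isClosed_of_isClosed ?_ D.isClosed_bounded
      (isClosed_singleton (x := D.row i))
    refine continuousOn_tsum (fun j => (continuous_apply (i, j)).continuousOn) D.summable_col ?_
    intro j w hw
    rw [Real.norm_of_nonneg (hw (i, j)).1]
    exact (hw (i, j)).2.2.1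
  have hcol : ∀ j, IsClosed (D.bounded ∩ {w | ∑' i, w (i, j) = D.col j}) := by
    intro j
    refine ContinuousOn.preimage_isClosed_of_isClosed ?_ D.isClosed_bounded
      (isClosed_singleton (x := D.col j))
    refine continuousOn_tsum (fun i => (continuous_apply (i, j)).continuousOn) D.summable_row ?_
    intro i w hw
    rw [Real.norm_of_nonneg (hw (i, j)).1]
    exact (hw (i, j)).2.1
  have hlen : IsClosed {w : I × J → ℝ | ∀ A, MeasurableSet A →
      ∑' p, ENNReal.ofReal (w p) * D.Λ p A ≤ D.total A} := by
    simp only [ENNReal.tsum_eq_iSup_sum, iSup_le_iff, ofPred_forall]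
    refine isClosed_iInter fun A => isClosed_iInter fun _ => isClosed_iInter fun F => ?_
    refine isClosed_le (continuous_finsetSum F fun p _ => ?_) continuous_const
    have := D.isFiniteMeasure_Λ p
    exact (ENNReal.continuous_mul_const (measure_ne_top (D.Λ p) A)).comp
      (ENNReal.continuous_ofReal.comp (continuous_apply p))
  have heq : D.admissible = D.bounded ∩
      ((⋂ i, D.bounded ∩ {w | ∑' j, w (i, j) = D.row i}) ∩
      ((⋂ j, D.bounded ∩ {w | ∑' i, w (i, j) = D.col j}) ∩
        {w | ∀ A, MeasurableSet A → ∑' p, ENNReal.ofReal (w p) * D.Λ p A ≤ D.total A})) := by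
    ext w
    simp only [admissible, mem_inter_iff, mem_iInter, mem_ofPred_eq]
    exact ⟨fun h => ⟨h.1, fun i => ⟨h.1, h.2.1 i⟩, fun j => ⟨h.1, h.2.2.1 j⟩, h.2.2.2⟩,
      fun h => ⟨h.1, fun i => (h.2.1 i).2, fun j => (h.2.2.1 j).2, h.2.2.2⟩⟩
  rw [heq]
  exact D.isClosed_bounded.inter ((isClosed_iInter hrow).inter ((isClosed_iInter hcol).inter hlen))

theorem isCompact_competitors (D : WeightedFamily I J X Ω) : IsCompact D.competitors := by
  have hcl : IsClosed D.competitors := by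
    have heq : D.competitors = D.admissible ∩
        ⋂ ω, (D.admissible ∩ {w | ∑' p, w p * D.S ω p = ∑' p, D.c p * D.S ω p}) := by
      ext w
      simp only [competitors, mem_inter_iff, mem_iInter, mem_ofPred_eq]
      exact ⟨fun h => ⟨h.1, fun ω => ⟨h.1, h.2 ω⟩⟩, fun h => ⟨h.1, fun ω => (h.2 ω).2⟩⟩
    rw [heq]
    exact D.isClosed_admissible.inter (isClosed_iInter fun ω =>
      (D.continuousOn_tsum_mul_S ω).preimage_isClosed_of_isClosed D.isClosed_admissible
        isClosed_singleton)
  have hcpt := isCompact_univ_pi fun p : I × J => isCompact_Icc (a := 0) (b := D.row p.1)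
  exact hcpt.of_isClosed_subset hcl fun w hw p _ => ⟨(hw.1.1 p).1, (hw.1.1 p).2.1⟩

/-- A linear functional with summable coefficients attains its maximum on the competitors. -/
theorem exists_isMaxOn (D : WeightedFamily I J X Ω) {φ : I × J → ℝ} (hφ : Summable φ)
    (hφ0 : ∀ p, 0 ≤ φ p) :
    ∃ w ∈ D.competitors, IsMaxOn (fun w : I × J → ℝ => ∑' p, w p * φ p) D.competitors w ∧
      ∀ w ∈ D.competitors, Summable fun p => w p * φ p := by
  have hb : ∀ w ∈ D.competitors, ∀ p, ‖w p * φ p‖ ≤ (∑' i, D.row i) * φ p := by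
    intro w hw p
    rw [norm_mul, Real.norm_of_nonneg (hw.1.1 p).1, Real.norm_of_nonneg (hφ0 p)]
    refine mul_le_mul_of_nonneg_right ((hw.1.1 p).2.1.trans ?_) (hφ0 p)
    exact D.summable_row.le_tsum p.1 fun i _ => tsum_nonneg fun j => D.nonneg _
  obtain ⟨w, hw, hmax⟩ := D.isCompact_competitors.exists_isMaxOn ⟨D.c, c_mem_competitors⟩
    (f := fun w : I × J → ℝ => ∑' p, w p * φ p)
    (continuousOn_tsum (fun p => ((continuous_apply p).mul_const _).continuousOn)
      (hφ.mul_left _) fun p w hw => hb w hw p)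
  exact ⟨w, hw, hmax, fun w hw => (hφ.mul_left _).of_norm_bounded (hb w hw)⟩

section Exchange

variable [DecidableEq I] [DecidableEq J]

/-- The direction of redistribution which increases the weights of `(i₁, j₁)` and `(i₂, j₂)` and
decreases those of `(i₁, j₂)` and `(i₂, j₁)`. -/
def exchange (i₁ i₂ : I) (j₁ j₂ : J) : I × J → ℝ :=
  Pi.single (i₁, j₁) 1 + Pi.single (i₂, j₂) 1 - Pi.single (i₁, j₂) 1 - Pi.single (i₂, j₁) 1

theorem hasSum_single_mul (q : I × J) (L : I × J → ℝ) :
    HasSum (fun p => (Pi.single q 1 : I × J → ℝ) p * L p) (L q) := by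
  have := hasSum_single (f := fun p => (Pi.single q 1 : I × J → ℝ) p * L p) q
    fun p hp => by simp [hp]
  simpa using this

theorem hasSum_exchange_mul (i₁ i₂ : I) (j₁ j₂ : J) (L : I × J → ℝ) :
    HasSum (fun p => exchange i₁ i₂ j₁ j₂ p * L p)
      (L (i₁, j₁) + L (i₂, j₂) - L (i₁, j₂) - L (i₂, j₁)) := by
  have := (((hasSum_single_mul (i₁, j₁) L).add (hasSum_single_mul (i₂, j₂) L)).sub
    (hasSum_single_mul (i₁, j₂) L)).sub (hasSum_single_mul (i₂, j₁) L)
  refine this.congr_fun fun p => ?_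
  simp only [exchange, Pi.add_apply, Pi.sub_apply]
  ring

theorem hasSum_single_row (q : I × J) (i : I) :
    HasSum (fun j => (Pi.single q 1 : I × J → ℝ) (i, j)) (if i = q.1 then 1 else 0) := by
  have h := hasSum_single (f := fun j => (Pi.single q 1 : I × J → ℝ) (i, j)) q.2 fun j hj => by
    rw [Pi.single_eq_of_ne]
    exact fun h => hj (congrArg Prod.snd h)
  convert! h using 1
  simp [Pi.single_apply, Prod.ext_iff]

theorem hasSum_single_col (q : I × J) (j : J) :
    HasSum (fun i => (Pi.single q 1 : I × J → ℝ) (i, j)) (if j = q.2 then 1 else 0) := by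
  have h := hasSum_single (f := fun i => (Pi.single q 1 : I × J → ℝ) (i, j)) q.1 fun i hi => by
    rw [Pi.single_eq_of_ne]
    exact fun h => hi (congrArg Prod.fst h)
  convert! h using 1
  simp [Pi.single_apply, Prod.ext_iff]

theorem hasSum_exchange_row (i₁ i₂ : I) (j₁ j₂ : J) (i : I) :
    HasSum (fun j => exchange i₁ i₂ j₁ j₂ (i, j)) 0 := by
  have := (((hasSum_single_row (i₁, j₁) i).add (hasSum_single_row (i₂, j₂) i)).sub
    (hasSum_single_row (i₁, j₂) i)).sub (hasSum_single_row (i₂, j₁) i)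
  convert! this using 1
  simp

theorem hasSum_exchange_col (i₁ i₂ : I) (j₁ j₂ : J) (j : J) :
    HasSum (fun i => exchange i₁ i₂ j₁ j₂ (i, j)) 0 := by
  have := (((hasSum_single_col (i₁, j₁) j).add (hasSum_single_col (i₂, j₂) j)).sub
    (hasSum_single_col (i₁, j₂) j)).sub (hasSum_single_col (i₂, j₁) j)
  convert! this using 1
  simp

/-- Competitors may be moved in the direction of an exchange between classes whose currents and
length measures are linearly related. -/
theorem add_exchange_mem_competitors {i₁ i₂ : I} {j₁ j₂ : J} (hi : i₁ ≠ i₂)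
    (hw : w ∈ D.competitors) {t : ℝ} (ht : 0 ≤ t)
    (h₁₂ : t ≤ w (i₁, j₂)) (h₂₁ : t ≤ w (i₂, j₁))
    (hc₁₁ : D.c (i₁, j₁) ≠ 0) (hc₂₂ : D.c (i₂, j₂) ≠ 0)
    (hc₁₂ : D.c (i₁, j₂) ≠ 0) (hc₂₁ : D.c (i₂, j₁) ≠ 0)
    (hS : ∀ ω, D.S ω (i₁, j₁) + D.S ω (i₂, j₂) = D.S ω (i₁, j₂) + D.S ω (i₂, j₁))
    (hΛ : D.Λ (i₁, j₁) + D.Λ (i₂, j₂) = D.Λ (i₁, j₂) + D.Λ (i₂, j₁)) :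
    (fun p => w p + t * exchange i₁ i₂ j₁ j₂ p) ∈ D.competitors := by
  have hnn : ∀ q p, (0 : ℝ) ≤ (Pi.single q 1 : I × J → ℝ) p := fun q p => by
    rw [Pi.single_apply]; split_ifs <;> norm_num
  have hne : ((i₁, j₂) : I × J) ≠ (i₂, j₁) := fun h => hi (congrArg Prod.fst h)
  -- The inequality and the identity are kept free of subtractions, to be used in `ℝ≥0∞` as well.
  have hlow : ∀ p, t * (Pi.single (i₁, j₂) 1 : I × J → ℝ) p +
      t * (Pi.single (i₂, j₁) 1 : I × J → ℝ) p ≤ w p := by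
    intro p
    rcases eq_or_ne p (i₁, j₂) with rfl | hp
    · simpa [Pi.single_eq_of_ne hne] using h₁₂
    rcases eq_or_ne p (i₂, j₁) with rfl | hp'
    · simpa [Pi.single_eq_of_ne hne.symm] using h₂₁
    · simpa [hp, hp'] using (hw.1.1 p).1
  have hbal : ∀ p, (w p + t * exchange i₁ i₂ j₁ j₂ p) +
      (t * (Pi.single (i₁, j₂) 1 : I × J → ℝ) p + t * (Pi.single (i₂, j₁) 1 : I × J → ℝ) p) =
      w p + (t * (Pi.single (i₁, j₁) 1 : I × J → ℝ) p +
        t * (Pi.single (i₂, j₂) 1 : I × J → ℝ) p) := by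
    intro p
    simp only [exchange, Pi.add_apply, Pi.sub_apply]
    ring
  have hpos : ∀ p, 0 ≤ w p + t * exchange i₁ i₂ j₁ j₂ p := by
    intro p
    have h1 := hbal p
    have h2 := hlow p
    have h3 := mul_nonneg ht (hnn (i₁, j₁) p)
    have h4 := mul_nonneg ht (hnn (i₂, j₂) p)
    linarith
  have hrow : ∀ i, HasSum (fun j => w (i, j) + t * exchange i₁ i₂ j₁ j₂ (i, j)) (D.row i) := by
    intro i
    have h1 := (summable_row_of_mem hw.1.1 i).hasSum
    rw [hw.1.2.1 i] at h1
    simpa using h1.add ((hasSum_exchange_row i₁ i₂ j₁ j₂ i).mul_left t)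
  have hcol : ∀ j, HasSum (fun i => w (i, j) + t * exchange i₁ i₂ j₁ j₂ (i, j)) (D.col j) := by
    intro j
    have h1 := (summable_col_of_mem hw.1.1 j).hasSum
    rw [hw.1.2.2.1 j] at h1
    simpa using h1.add ((hasSum_exchange_col i₁ i₂ j₁ j₂ j).mul_left t)
  refine ⟨⟨fun p => ⟨hpos p, ?_, ?_, fun hcp => ?_⟩, fun i => (hrow i).tsum_eq,
    fun j => (hcol j).tsum_eq, fun A hA => ?_⟩, fun ω => ?_⟩
  · exact le_hasSum (hrow p.1) p.2 fun j _ => hpos (p.1, j)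
  · exact le_hasSum (hcol p.2) p.1 fun i _ => hpos (i, p.2)
  · have h1 : ∀ q, D.c q ≠ 0 → (Pi.single q 1 : I × J → ℝ) p = 0 := fun q hq =>
      Pi.single_eq_of_ne (fun h => hq (by rw [← h]; exact hcp)) _
    simp [(hw.1.1 p).2.2.2 hcp, exchange, h1 _ hc₁₁, h1 _ hc₁₂, h1 _ hc₂₁, h1 _ hc₂₂]
  · have hsingle : ∀ q, ∑' p, ENNReal.ofReal (t * (Pi.single q 1 : I × J → ℝ) p) * D.Λ p A =
        ENNReal.ofReal t * D.Λ q A := by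
      intro q
      rw [tsum_eq_single q fun p hp => by simp [hp]]
      simp
    have h1 : ∑' p, ENNReal.ofReal (w p + t * exchange i₁ i₂ j₁ j₂ p) * D.Λ p A +
        (ENNReal.ofReal t * D.Λ (i₁, j₂) A + ENNReal.ofReal t * D.Λ (i₂, j₁) A) =
        ∑' p, ENNReal.ofReal (w p) * D.Λ p A +
        (ENNReal.ofReal t * D.Λ (i₁, j₁) A + ENNReal.ofReal t * D.Λ (i₂, j₂) A) := by
      rw [← hsingle, ← hsingle, ← hsingle, ← hsingle, ← ENNReal.tsum_add, ← ENNReal.tsum_add,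
        ← ENNReal.tsum_add, ← ENNReal.tsum_add]
      refine tsum_congr fun p => ?_
      have hp := fun q => mul_nonneg ht (hnn q p)
      rw [← add_mul, ← add_mul, ← add_mul, ← add_mul, ← ENNReal.ofReal_add (hp _) (hp _),
        ← ENNReal.ofReal_add (hp _) (hp _), ← ENNReal.ofReal_add (hpos p)
          (add_nonneg (hp _) (hp _)), ← ENNReal.ofReal_add (hw.1.1 p).1
          (add_nonneg (hp _) (hp _)), hbal]
    have h2 : D.Λ (i₁, j₁) A + D.Λ (i₂, j₂) A = D.Λ (i₁, j₂) A + D.Λ (i₂, j₁) A := by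
      rw [← Measure.add_apply, hΛ, Measure.add_apply]
    rw [← mul_add, ← mul_add, h2] at h1
    have := D.isFiniteMeasure_Λ
    rw [ENNReal.add_left_inj (by finiteness)] at h1
    rw [h1]
    exact hw.1.2.2.2 A hA
  · have h1 := (summable_mul_S hw.1 ω).hasSum.add
      ((hasSum_exchange_mul i₁ i₂ j₁ j₂ (D.S ω)).mul_left t)
    rw [← hw.2 ω]
    have h2 : D.S ω (i₁, j₁) + D.S ω (i₂, j₂) - D.S ω (i₁, j₂) - D.S ω (i₂, j₁) = 0 := by
      linarith [hS ω]
    rw [h2, mul_zero, add_zero] at h1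
    refine (h1.congr_fun fun p => ?_).tsum_eq
    ring

/-- There are competitors which admit no exchange increasing a functional `∑ w (i, j) u i v j` with
`u` and `v` summable: the maximizers of this functional. -/
theorem exists_competitor_forall_not_exchange (D : WeightedFamily I J X Ω) {u : I → ℝ} {v : J → ℝ}
    (hu : Summable u) (hu0 : ∀ i, 0 ≤ u i) (hv : Summable v) (hv0 : ∀ j, 0 ≤ v j) :
    ∃ w ∈ D.competitors, ∀ i₁ i₂ j₁ j₂, u i₂ < u i₁ → v j₂ < v j₁ →
      (∀ ω, D.S ω (i₁, j₁) + D.S ω (i₂, j₂) = D.S ω (i₁, j₂) + D.S ω (i₂, j₁)) →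
      D.Λ (i₁, j₁) + D.Λ (i₂, j₂) = D.Λ (i₁, j₂) + D.Λ (i₂, j₁) →
      ¬(0 < w (i₁, j₁) ∧ 0 < w (i₁, j₂) ∧ 0 < w (i₂, j₁) ∧ 0 < w (i₂, j₂)) := by
  obtain ⟨w, hw, hmax, hsum⟩ := D.exists_isMaxOn (φ := fun p => u p.1 * v p.2)
    (hu.mul_of_nonneg hv hu0 hv0) fun p => mul_nonneg (hu0 _) (hv0 _)
  refine ⟨w, hw, fun i₁ i₂ j₁ j₂ hui hvj hS hΛ ⟨h₁₁, h₁₂, h₂₁, h₂₂⟩ => ?_⟩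
  have hc : ∀ p, 0 < w p → D.c p ≠ 0 := fun p hp h0 => hp.ne' ((hw.1.1 p).2.2.2 h0)
  set t := min (w (i₁, j₂)) (w (i₂, j₁))
  have ht : 0 < t := lt_min h₁₂ h₂₁
  have hw' := add_exchange_mem_competitors (fun h => hui.ne' (congrArg u h)) hw ht.le
    (min_le_left _ _) (min_le_right _ _)
    (hc _ h₁₁) (hc _ h₂₂) (hc _ h₁₂) (hc _ h₂₁) hS hΛ
  have h1 := (hsum w hw).hasSum.add
    ((hasSum_exchange_mul i₁ i₂ j₁ j₂ fun p => u p.1 * v p.2).mul_left t)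
  have h2 : ∑' p, (w p + t * exchange i₁ i₂ j₁ j₂ p) * (u p.1 * v p.2) = _ :=
    (h1.congr_fun fun p => by ring).tsum_eq
  have h3 : ∑' p, (w p + t * exchange i₁ i₂ j₁ j₂ p) * (u p.1 * v p.2) ≤
    ∑' p, w p * (u p.1 * v p.2) := hmax hw'
  rw [h2] at h3
  nlinarith [mul_pos ht (mul_pos (sub_pos.2 hui) (sub_pos.2 hvj))]

end Exchange

end WeightedFamily

end TransportPath

/-! ### The classes of curves of a good decomposition -/

namespace TransportPath

variable {m : ℕ} {M N : ℕ∞} {x : Idx M → E m} {y : Idx N → E m}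

theorem atomicMeasure_univ (a : Idx M → ℝ≥0) (x : Idx M → E m) :
    atomicMeasure a x univ = ∑' i, (a i : ℝ≥0∞) := by
  simp [atomicMeasure, Measure.sum_apply _ MeasurableSet.univ]

theorem atomicMeasure_compl_range (a : Idx M → ℝ≥0) (x : Idx M → E m) :
    atomicMeasure a x (range x)ᶜ = 0 := by
  have hm : MeasurableSet (range x)ᶜ := (countable_range x).measurableSet.compl
  simp [atomicMeasure, Measure.sum_apply _ hm, Measure.dirac_apply' _ hm]

theorem measurableSet_class (p : Idx M × Idx N) :
    MeasurableSet (curvesBetween (x p.1) (y p.2)) :=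
  measurableSet_curvesBetween _ _

theorem pairwise_disjoint_classes (hx : Function.Injective x) (hy : Function.Injective y) :
    Pairwise (Function.onFun Disjoint fun p : Idx M × Idx N => curvesBetween (x p.1) (y p.2)) := by
  intro p q hpq
  refine disjoint_left.2 fun γ hp hq => hpq (Prod.ext (hx ?_) (hy ?_))
  · exact hp.1.symm.trans hq.1
  · exact hp.2.symm.trans hq.2

namespace IsGoodDecomposition

variable {η : Measure (LipCurve m)} {T : Current1 m}

/-- The equation `∂T = ν - μ`, with all terms positive, for the marginals of the decomposition. -/
theorem map_endPt_add (h : IsGoodDecomposition η T) {μ ν : Measure (E m)} [IsFiniteMeasure μ]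
    [IsFiniteMeasure ν] (hT : IsTransportPath T μ ν) :
    η.map LipCurve.endPt + μ = η.map LipCurve.startPt + ν := by
  have := h.finite
  have key : ∀ χ : Form0 m, (∀ z, 0 ≤ χ z) →
      ∫⁻ z, ENNReal.ofReal (χ z) ∂(η.map LipCurve.endPt + μ) =
      ∫⁻ z, ENNReal.ofReal (χ z) ∂(η.map LipCurve.startPt + ν) := by
    intro χ h0
    rw [← ofReal_integral_eq_lintegral_ofReal (integrable_form0 χ _) (ae_of_all _ h0),
      ← ofReal_integral_eq_lintegral_ofReal (integrable_form0 χ _) (ae_of_all _ h0),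
      integral_add_measure (integrable_form0 χ _) (integrable_form0 χ _),
      integral_add_measure (integrable_form0 χ _) (integrable_form0 χ _)]
    have h1 := h.integral_endpoints χ
    rw [hT.2 χ] at h1
    congr 1
    linarith
  exact le_antisymm (measure_le_of_forall_form0 fun χ h0 _ => (key χ h0).le)
    (measure_le_of_forall_form0 fun χ h0 _ => (key χ h0).ge)

/-- Almost every curve of a good decomposition of a transport path joins one of the sources to one
of the targets. -/
theorem ae_exists_mem_class (h : IsGoodDecomposition η T) {a : Idx M → ℝ≥0} {b : Idx N → ℝ≥0}
    (ha : ∑' i, (a i : ℝ≥0∞) < ∞) (hb : ∑' j, (b j : ℝ≥0∞) < ∞)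
    (hT : IsTransportPath T (atomicMeasure a x) (atomicMeasure b y)) :
    ∀ᵐ γ ∂η, ∃ p : Idx M × Idx N, γ ∈ curvesBetween (x p.1) (y p.2) := by
  have : IsFiniteMeasure (atomicMeasure a x) := ⟨by rwa [atomicMeasure_univ]⟩
  have : IsFiniteMeasure (atomicMeasure b y) := ⟨by rwa [atomicMeasure_univ]⟩
  have hadd := h.map_endPt_add hT
  have hX : MeasurableSet (range x)ᶜ := (countable_range x).measurableSet.compl
  have hY : MeasurableSet (range y)ᶜ := (countable_range y).measurableSet.compl
  -- Off the sources, the initial marginal is dominated by the final one, so it vanishes there.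
  have hstart : (η.map LipCurve.startPt).restrict (range x)ᶜ = 0 := by
    refine h.eq_zero_of_le_marginals Measure.restrict_le_self ?_
    calc (η.map LipCurve.startPt).restrict (range x)ᶜ
        ≤ (η.map LipCurve.startPt + atomicMeasure b y).restrict (range x)ᶜ :=
          Measure.restrict_mono subset_rfl (Measure.le_add_right le_rfl)
      _ = (η.map LipCurve.endPt).restrict (range x)ᶜ := by
          rw [← hadd, Measure.restrict_add,
            Measure.restrict_eq_zero.2 (atomicMeasure_compl_range a x), add_zero]
      _ ≤ _ := Measure.restrict_le_self
  have hend : (η.map LipCurve.endPt).restrict (range y)ᶜ = 0 := by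
    refine h.eq_zero_of_le_marginals ?_ Measure.restrict_le_self
    calc (η.map LipCurve.endPt).restrict (range y)ᶜ
        ≤ (η.map LipCurve.endPt + atomicMeasure a x).restrict (range y)ᶜ :=
          Measure.restrict_mono subset_rfl (Measure.le_add_right le_rfl)
      _ = (η.map LipCurve.startPt).restrict (range y)ᶜ := by
          rw [hadd, Measure.restrict_add,
            Measure.restrict_eq_zero.2 (atomicMeasure_compl_range b y), add_zero]
      _ ≤ _ := Measure.restrict_le_self
  rw [Measure.restrict_eq_zero,
    Measure.map_apply LipCurve.continuous_startPt.measurable hX] at hstart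
  rw [Measure.restrict_eq_zero, Measure.map_apply LipCurve.measurable_endPt hY] at hend
  filter_upwards [compl_mem_ae_iff.2 hstart, compl_mem_ae_iff.2 hend] with γ h1 h2
  simp only [mem_compl_iff, mem_preimage, not_not] at h1 h2
  obtain ⟨i, hi⟩ := h1
  obtain ⟨j, hj⟩ := h2
  exact ⟨(i, j), hi.symm, hj.symm⟩

/-- A point cannot be both a starting point and an end point of a non-negligible set of curves. -/
theorem source_ne_target (h : IsGoodDecomposition η T) {z z' w w' : E m}
    (hz : 0 < η (curvesBetween z w)) (hw : 0 < η (curvesBetween z' w')) : z ≠ w' := by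
  rintro rfl
  have h1 : η (curvesBetween z w) ≤ η.map LipCurve.startPt {z} := by
    rw [Measure.map_apply LipCurve.continuous_startPt.measurable (measurableSet_singleton z)]
    exact measure_mono fun γ hγ => hγ.1
  have h2 : η (curvesBetween z' z) ≤ η.map LipCurve.endPt {z} := by
    rw [Measure.map_apply LipCurve.measurable_endPt (measurableSet_singleton z)]
    exact measure_mono fun γ hγ => hγ.2
  have key : ∀ (ν : Measure (E m)) (k : ℝ≥0∞), k ≤ ν {z} → k • Measure.dirac z ≤ ν := by
    intro ν k hk
    refine Measure.le_iff.2 fun A hA => ?_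
    rw [Measure.smul_apply, Measure.dirac_apply' _ hA, smul_eq_mul]
    by_cases hzA : z ∈ A
    · simpa [hzA] using hk.trans (measure_mono (singleton_subset_iff.2 hzA))
    · simp [hzA]
  have h3 := h.eq_zero_of_le_marginals
    (r := min (η (curvesBetween z w)) (η (curvesBetween z' z)) • Measure.dirac z)
    (key _ _ ((min_le_left _ _).trans h1)) (key _ _ ((min_le_right _ _).trans h2))
  have h4 := congrArg (fun ν : Measure (E m) => ν univ) h3
  simp only [Measure.smul_apply, measure_univ, smul_eq_mul, mul_one, Measure.coe_zero,
    Pi.zero_apply] at h4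
  exact (lt_min hz hw).ne' h4

theorem normalizedCurrent_extDeriv0 (h : IsGoodDecomposition η T) {z w : E m} (f : Form0 m) :
    normalizedCurrent η z w (extDeriv0 f) =
      if 0 < η (curvesBetween z w) then f w - f z else 0 := by
  have := h.finite
  rw [normalizedCurrent]
  split_ifs with hpos
  · have h1 : classCurrent η z w (extDeriv0 f) = η.real (curvesBetween z w) * (f w - f z) := by
      rw [classCurrent, ← smul_eq_mul, ← setIntegral_const]
      refine setIntegral_congr_ae (measurableSet_curvesBetween z w) ?_
      filter_upwards [h.supported] with γ hγ hmem
      rw [← hmem.1, ← hmem.2]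
      exact hγ.2.boundary_current hγ.1 f
    rw [Pi.smul_apply, h1, smul_eq_mul, Measure.real, inv_mul_cancel_left₀]
    exact (ENNReal.toReal_pos hpos.ne' (measure_ne_top _ _)).ne'
  · rfl

/-- In a relation `S₁₁ - S₁₂ - S₂₁ + S₂₂ = 0`, either all or none of the four classes are
negligible, by comparison of the boundaries. -/
theorem classes_pos_or_eq_zero (h : IsGoodDecomposition η T) {x₁ x₂ y₁ y₂ : E m} (hx : x₁ ≠ x₂)
    (hy : y₁ ≠ y₂)
    (hrel : normalizedCurrent η x₁ y₁ - normalizedCurrent η x₁ y₂ - normalizedCurrent η x₂ y₁ +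
      normalizedCurrent η x₂ y₂ = 0) :
    (0 < η (curvesBetween x₁ y₁) ∧ 0 < η (curvesBetween x₁ y₂) ∧
      0 < η (curvesBetween x₂ y₁) ∧ 0 < η (curvesBetween x₂ y₂)) ∨
    (η (curvesBetween x₁ y₁) = 0 ∧ η (curvesBetween x₁ y₂) = 0 ∧
      η (curvesBetween x₂ y₁) = 0 ∧ η (curvesBetween x₂ y₂) = 0) := by
  classical
  set s : E m → E m → ℝ := fun z w => if 0 < η (curvesBetween z w) then 1 else 0 with hs
  have hs' : ∀ z w (f : Form0 m), normalizedCurrent η z w (extDeriv0 f) = s z w * (f w - f z) := by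
    intro z w f
    rw [h.normalizedCurrent_extDeriv0]
    by_cases hp : 0 < η (curvesBetween z w)
    · simp only [hs, if_pos hp, one_mul]
    · simp only [hs, if_neg hp, zero_mul]
  have hrel' : ∀ f : Form0 m, s x₁ y₁ * (f y₁ - f x₁) - s x₁ y₂ * (f y₂ - f x₁)
      - s x₂ y₁ * (f y₁ - f x₂) + s x₂ y₂ * (f y₂ - f x₂) = 0 := by
    intro f
    simpa [hs'] using congrFun hrel (extDeriv0 f)
  have hbump : ∀ (z : E m) (F : Finset (E m)),
      ∃ f : Form0 m, f z = 1 ∧ ∀ w ∈ F, w ≠ z → f w = 0 := by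
    intro z F
    obtain ⟨f, -, -, h1, h2⟩ := exists_form0_one_on_compact (isCompact_singleton (x := z))
      (F.erase z).finite_toSet.isClosed.isOpen_compl (by simp)
    exact ⟨f, h1 z rfl, fun w hw hwz => h2 w (by simp [hw, hwz])⟩
  -- The coefficient of a source in the boundary vanishes, because a source is not a target.
  have hrow : ∀ z z' : E m, z ≠ z' → (∀ f : Form0 m, s z y₁ * (f y₁ - f z) - s z y₂ * (f y₂ - f z)
      - s z' y₁ * (f y₁ - f z') + s z' y₂ * (f y₂ - f z') = 0) → s z y₁ = s z y₂ := by
    intro z z' hzz' hf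
    by_contra hne
    have hsrc : ∃ w, 0 < η (curvesBetween z w) := by
      by_contra! hcon
      exact hne (by simp [hs, fun w => nonpos_iff_eq_zero.1 (hcon w)])
    obtain ⟨w, hw⟩ := hsrc
    obtain ⟨f, hfz, hf0⟩ := hbump z {z', y₁, y₂}
    have hzero : ∀ v ∈ ({y₁, y₂} : Set (E m)), ∀ u, s u v * f v = 0 := by
      intro v hv u
      rcases eq_or_ne v z with rfl | hvz
      · have : ¬ 0 < η (curvesBetween u v) := fun hpos => h.source_ne_target hw hpos rfl
        simp [hs, this]
      · rw [hf0 v (by rcases hv with rfl | hv <;> simp_all) hvz, mul_zero]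
    have h1 := hf f
    simp only [mul_sub, hzero y₁ (by simp), hzero y₂ (by simp), hfz,
      hf0 z' (by simp) hzz'.symm] at h1
    exact hne (by linarith)
  have h1 := hrow x₁ x₂ hx hrel'
  have h2 := hrow x₂ x₁ hx.symm fun f => by linarith [hrel' f]
  obtain ⟨f, hf1, hf0⟩ := hbump y₁ {y₂}
  have h3 := hrel' f
  rw [← h1, ← h2, hf1, hf0 y₂ (by simp) hy.symm] at h3
  have h4 : s x₁ y₁ = s x₂ y₁ := by linarith
  have hiff : ∀ z w z' w', s z w = s z' w' →
      (0 < η (curvesBetween z w) ↔ 0 < η (curvesBetween z' w')) := by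
    intro z w z' w' he
    simp only [hs] at he
    split_ifs at he <;> simp_all
  by_cases hpos : 0 < η (curvesBetween x₁ y₁)
  · exact Or.inl ⟨hpos, (hiff _ _ _ _ h1).1 hpos, (hiff _ _ _ _ h4).1 hpos,
      (hiff _ _ _ _ (h4.trans h2)).1 hpos⟩
  · have hz : ∀ z w, ¬0 < η (curvesBetween z w) → η (curvesBetween z w) = 0 := fun z w hn =>
      nonpos_iff_eq_zero.1 (not_lt.1 hn)
    exact Or.inr ⟨hz _ _ hpos, hz _ _ fun h' => hpos ((hiff _ _ _ _ h1).2 h'),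
      hz _ _ fun h' => hpos ((hiff _ _ _ _ h4).2 h'),
      hz _ _ fun h' => hpos ((hiff _ _ _ _ (h4.trans h2)).2 h')⟩

end IsGoodDecomposition

/-! ### The weighted family of a good decomposition -/

/-- The normalized length measure of a class of curves. -/
noncomputable def classLength (η : Measure (LipCurve m)) (z w : E m) : Measure (E m) :=
  (η (curvesBetween z w))⁻¹ • totalLength (η.restrict (curvesBetween z w))

namespace IsGoodDecomposition

variable {η : Measure (LipCurve m)} {T : Current1 m}

theorem mul_classLength (h : IsGoodDecomposition η T) (z w : E m) (A : Set (E m)) :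
    η (curvesBetween z w) * classLength η z w A =
      totalLength (η.restrict (curvesBetween z w)) A := by
  have := h.finite
  rcases eq_or_ne (η (curvesBetween z w)) 0 with h0 | h0
  · rw [h0, Measure.restrict_eq_zero.2 h0]
    simp [totalLength]
  · rw [classLength, Measure.smul_apply, smul_eq_mul, ← mul_assoc,
      ENNReal.mul_inv_cancel h0 (measure_ne_top _ _), one_mul]

theorem isFiniteMeasure_classLength (h : IsGoodDecomposition η T) (z w : E m) :
    IsFiniteMeasure (classLength η z w) := by
  have := h.isFiniteMeasure_totalLength_restrict (curvesBetween z w)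
  refine ⟨?_⟩
  rcases eq_or_ne (η (curvesBetween z w)) 0 with h0 | h0
  · rw [classLength, Measure.restrict_eq_zero.2 h0]
    simp [totalLength]
  · rw [classLength, Measure.smul_apply, smul_eq_mul]
    exact ENNReal.mul_lt_top (ENNReal.inv_lt_top.2 (pos_iff_ne_zero.2 h0)) (measure_lt_top _ _)

/-- A simple curve has multiplicity at most one, so the average length measure of a class is at
most `ℋ¹`. -/
theorem classLength_le_hausdorffMeasure (h : IsGoodDecomposition η T) (z w : E m) :
    classLength η z w ≤ μH[1] := by
  refine Measure.le_iff.2 fun A hA => ?_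
  rw [classLength, Measure.smul_apply, smul_eq_mul, totalLength_apply _ hA]
  have h1 : ∫⁻ γ in curvesBetween z w, γ.lengthMeasure A ∂η ≤
      ∫⁻ γ in curvesBetween z w, μH[1] A ∂η := by
    refine lintegral_mono_ae (ae_restrict_of_ae ?_)
    filter_upwards [h.supported] with γ hγ
    rw [← hγ.2.hausdorffMeasure_restrict_range hγ.1]
    exact Measure.restrict_apply_le _ _
  rw [setLIntegral_const] at h1
  calc (η (curvesBetween z w))⁻¹ * ∫⁻ γ in curvesBetween z w, γ.lengthMeasure A ∂η
      ≤ (η (curvesBetween z w))⁻¹ * (μH[1] A * η (curvesBetween z w)) := by gcongr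
    _ = (η (curvesBetween z w))⁻¹ * η (curvesBetween z w) * μH[1] A := by ring
    _ ≤ 1 * μH[1] A := by gcongr; exact ENNReal.inv_mul_le_one _
    _ = μH[1] A := one_mul _

theorem enorm_normalizedCurrent_le (h : IsGoodDecomposition η T) (z w : E m) {ω : Form1 m}
    {C : ℝ≥0} (hω : ∀ v, ‖ω v‖ ≤ C) :
    ‖normalizedCurrent η z w ω‖ₑ ≤ C * classLength η z w univ := by
  have := h.finite
  rw [normalizedCurrent]
  split_ifs with hpos
  · have h1 : ‖classCurrent η z w ω‖ₑ ≤
        C * totalLength (η.restrict (curvesBetween z w)) univ := by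
      rw [totalLength_apply _ MeasurableSet.univ, ← lintegral_const_mul' _ _ ENNReal.coe_ne_top]
      refine (enorm_integral_le_lintegral_enorm _).trans
        (lintegral_mono_ae (ae_restrict_of_ae ?_))
      filter_upwards [h.supported] with γ hγ
      exact hγ.2.enorm_current_le hγ.1 hω
    rw [Pi.smul_apply, smul_eq_mul, enorm_mul, classLength, Measure.smul_apply, smul_eq_mul,
      mul_left_comm, Real.enorm_of_nonneg (by positivity), ENNReal.ofReal_inv_of_pos
        (ENNReal.toReal_pos hpos.ne' (measure_ne_top _ _)), ENNReal.ofReal_toReal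
        (measure_ne_top _ _)]
    gcongr
  · simp

/-- Linear relations between normalized currents are inherited by their length measures: by
`exists_form_near`, a single form `ω` localizes the length measures of all four classes, that is,
`χ ω` evaluated on each of the currents is close to the integral of `χ`. -/
theorem classLength_add_eq (h : IsGoodDecomposition η T) {x₁ x₂ y₁ y₂ : E m}
    (hrel : ∀ ω, normalizedCurrent η x₁ y₁ ω + normalizedCurrent η x₂ y₂ ω =
      normalizedCurrent η x₁ y₂ ω + normalizedCurrent η x₂ y₁ ω) :
    classLength η x₁ y₁ + classLength η x₂ y₂ = classLength η x₁ y₂ + classLength η x₂ y₁ := by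
  have := h.finite
  have hfin := h.isFiniteMeasure_classLength
  have happrox : ∀ (z w : E m) (χ : Form0 m) (ω : Form1 m) (ε : ℝ),
      |(∫ v, χ v ∂totalLength (η.restrict (curvesBetween z w))) -
        ∫ γ in curvesBetween z w, γ.current (mulForm χ ω) ∂η| ≤ ε →
      |(∫ v, χ v ∂classLength η z w) - normalizedCurrent η z w (mulForm χ ω)| ≤
        (η (curvesBetween z w)).toReal⁻¹ * ε := by
    intro z w χ ω ε hε
    have h1 : ∫ v, χ v ∂classLength η z w = (η (curvesBetween z w)).toReal⁻¹ *
        ∫ v, χ v ∂totalLength (η.restrict (curvesBetween z w)) := by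
      rw [classLength, integral_smul_measure, ENNReal.toReal_inv, smul_eq_mul]
    have h2 : normalizedCurrent η z w (mulForm χ ω) = (η (curvesBetween z w)).toReal⁻¹ *
        ∫ γ in curvesBetween z w, γ.current (mulForm χ ω) ∂η := by
      rw [normalizedCurrent]
      split_ifs with hpos
      · rfl
      · simp [nonpos_iff_eq_zero.1 (not_lt.1 hpos)]
    rw [h1, h2, ← mul_sub, abs_mul, abs_of_nonneg (by positivity)]
    gcongr
  have key : ∀ χ : Form0 m, (∀ v, 0 ≤ χ v) → (∀ v, χ v ≤ 1) →
      ∫⁻ v, ENNReal.ofReal (χ v) ∂(classLength η x₁ y₁ + classLength η x₂ y₂) =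
      ∫⁻ v, ENNReal.ofReal (χ v) ∂(classLength η x₁ y₂ + classLength η x₂ y₁) := by
    intro χ h0 h1
    rw [← ofReal_integral_eq_lintegral_ofReal (integrable_form0 χ _) (ae_of_all _ h0),
      ← ofReal_integral_eq_lintegral_ofReal (integrable_form0 χ _) (ae_of_all _ h0),
      integral_add_measure (integrable_form0 χ _) (integrable_form0 χ _),
      integral_add_measure (integrable_form0 χ _) (integrable_form0 χ _)]
    congr 1
    refine eq_of_abs_sub_le_all fun ε hε => ?_
    set k := (η (curvesBetween x₁ y₁)).toReal⁻¹ + (η (curvesBetween x₂ y₂)).toReal⁻¹ +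
      (η (curvesBetween x₁ y₂)).toReal⁻¹ + (η (curvesBetween x₂ y₁)).toReal⁻¹ + 1 with hk
    have hkpos : 0 < k := by positivity
    obtain ⟨ω, -, hω⟩ := h.exists_form_near (div_pos hε hkpos)
    have hχ : ∀ v, |χ v| ≤ 1 := fun v => by rw [abs_of_nonneg (h0 v)]; exact h1 v
    have e := fun z w => abs_le.1 (happrox z w χ ω _ (hω χ hχ (curvesBetween z w)))
    have hr := hrel (mulForm χ ω)
    have hsum : (k - 1) * (ε / k) ≤ ε := by
      have : k * (ε / k) = ε := mul_div_cancel₀ _ hkpos.ne'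
      nlinarith [div_pos hε hkpos]
    have hexp : (k - 1) * (ε / k) = (η (curvesBetween x₁ y₁)).toReal⁻¹ * (ε / k) +
        (η (curvesBetween x₂ y₂)).toReal⁻¹ * (ε / k) +
        (η (curvesBetween x₁ y₂)).toReal⁻¹ * (ε / k) +
        (η (curvesBetween x₂ y₁)).toReal⁻¹ * (ε / k) := by
      rw [hk]; ring
    rw [abs_le]
    constructor <;>
    linarith [(e x₁ y₁).1, (e x₁ y₁).2, (e x₂ y₂).1, (e x₂ y₂).2, (e x₁ y₂).1, (e x₁ y₂).2,
      (e x₂ y₁).1, (e x₂ y₁).2]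
  exact le_antisymm (measure_le_of_forall_form0 fun χ h0 h1 => (key χ h0 h1).le)
    (measure_le_of_forall_form0 fun χ h0 h1 => (key χ h0 h1).ge)

/-- The classes are pairwise disjoint, so their length measures add up to at most the total one. -/
theorem tsum_totalLength_class_le (hx : Function.Injective x) (hy : Function.Injective y)
    {A : Set (E m)} (hA : MeasurableSet A) :
    ∑' p : Idx M × Idx N, totalLength (η.restrict (curvesBetween (x p.1) (y p.2))) A ≤
      totalLength η A := by
  simp_rw [totalLength_apply _ hA]
  rw [← lintegral_iUnion (fun p => measurableSet_class p) (pairwise_disjoint_classes hx hy)]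
  exact setLIntegral_le_lintegral _ _

/-- The weighted family formed by the classes of curves of a good decomposition. -/
noncomputable def weightedFamily (h : IsGoodDecomposition η T) (hT : IsRectifiable T)
    (hx : Function.Injective x) (hy : Function.Injective y) :
    WeightedFamily (Idx M) (Idx N) (E m) (Form1 m) where
  c p := (η (curvesBetween (x p.1) (y p.2))).toReal
  Λ p := classLength η (x p.1) (y p.2)
  total := totalLength η
  S ω p := normalizedCurrent η (x p.1) (y p.2) ω
  bound ω := (exists_norm_form1_le ω).choose
  ρ := μH[1]
  nonneg _ := ENNReal.toReal_nonneg
  summable := by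
    have := h.finite
    refine ENNReal.summable_toReal ?_
    rw [← measure_iUnion (pairwise_disjoint_classes hx hy) fun p => measurableSet_class p]
    exact measure_ne_top _ _
  isFiniteMeasure_total := h.isFiniteMeasure_totalLength
  isFiniteMeasure_Λ _ := h.isFiniteMeasure_classLength _ _
  tsum_le A hA := by
    have := h.finite
    refine le_trans (le_of_eq (tsum_congr fun p => ?_)) (tsum_totalLength_class_le hx hy hA)
    rw [ENNReal.ofReal_toReal (measure_ne_top _ _), h.mul_classLength]
  enorm_S_le ω _ := h.enorm_normalizedCurrent_le _ _ (exists_norm_form1_le ω).choose_spec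
  Λ_le _ := h.classLength_le_hausdorffMeasure _ _
  exists_measure_lt_top _ hε := h.exists_hausdorffMeasure_lt_top hT hε

end IsGoodDecomposition

end TransportPath

/-! ### Redistribution of the weights of the classes -/

namespace TransportPath

variable {m : ℕ} {M N : ℕ∞} {x : Idx M → E m} {y : Idx N → E m} {η : Measure (LipCurve m)}
  {T : Current1 m} {w : Idx M × Idx N → ℝ}

/-- The measure on curves which is proportional to `η` on each class `Γ_{x_i,y_j}` and gives it the
weight `w (i, j)`. -/
noncomputable def redistribute (η : Measure (LipCurve m)) (x : Idx M → E m) (y : Idx N → E m)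
    (w : Idx M × Idx N → ℝ) : Measure (LipCurve m) :=
  Measure.sum fun p => (ENNReal.ofReal (w p) * (η (curvesBetween (x p.1) (y p.2)))⁻¹) •
    η.restrict (curvesBetween (x p.1) (y p.2))

theorem redistribute_absolutelyContinuous : redistribute η x y w ≪ η :=
  Measure.absolutelyContinuous_sum_left fun _ =>
    Measure.restrict_le_self.absolutelyContinuous.smul_left _

theorem redistribute_restrict_class (hx : Function.Injective x) (hy : Function.Injective y)
    (p : Idx M × Idx N) :
    (redistribute η x y w).restrict (curvesBetween (x p.1) (y p.2)) =
      (ENNReal.ofReal (w p) * (η (curvesBetween (x p.1) (y p.2)))⁻¹) •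
        η.restrict (curvesBetween (x p.1) (y p.2)) := by
  ext A hA
  rw [redistribute, Measure.restrict_sum _ (measurableSet_class p), Measure.sum_apply _ hA,
    tsum_eq_single p]
  · rw [Measure.restrict_smul, Measure.restrict_restrict (measurableSet_class p), inter_self]
  · intro q hq
    rw [Measure.restrict_smul, Measure.restrict_restrict (measurableSet_class p),
      (pairwise_disjoint_classes hx hy hq.symm).inter_eq]
    simp

theorem classCurrent_redistribute (hx : Function.Injective x) (hy : Function.Injective y)
    (p : Idx M × Idx N) :
    classCurrent (redistribute η x y w) (x p.1) (y p.2) =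
      (ENNReal.ofReal (w p) * (η (curvesBetween (x p.1) (y p.2)))⁻¹).toReal •
        classCurrent η (x p.1) (y p.2) := by
  ext ω
  rw [classCurrent, redistribute_restrict_class hx hy, integral_smul_measure]
  rfl

theorem totalLength_redistribute {A : Set (E m)} (hA : MeasurableSet A) :
    totalLength (redistribute η x y w) A =
      ∑' p, ENNReal.ofReal (w p) * classLength η (x p.1) (y p.2) A := by
  rw [totalLength_apply _ hA, redistribute, lintegral_sum_measure]
  refine tsum_congr fun p => ?_
  rw [lintegral_smul_measure, ← totalLength_apply _ hA, classLength, Measure.smul_apply,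
    smul_eq_mul, smul_eq_mul, mul_assoc]

namespace IsGoodDecomposition

theorem classCurrent_eq_smul (h : IsGoodDecomposition η T) (z z' : E m) :
    classCurrent η z z' = (η (curvesBetween z z')).toReal • normalizedCurrent η z z' := by
  have := h.finite
  rw [normalizedCurrent]
  split_ifs with hpos
  · rw [smul_smul, mul_inv_cancel₀ (ENNReal.toReal_pos hpos.ne' (measure_ne_top _ _)).ne', one_smul]
  · ext ω
    simp [classCurrent, Measure.restrict_eq_zero.2 (nonpos_iff_eq_zero.1 (not_lt.1 hpos))]

/-- The original weights give back `η`, because almost every curve lies in one of the classes. -/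
theorem redistribute_self (h : IsGoodDecomposition η T) (hx : Function.Injective x)
    (hy : Function.Injective y)
    (hmem : ∀ᵐ γ ∂η, ∃ p : Idx M × Idx N, γ ∈ curvesBetween (x p.1) (y p.2)) :
    redistribute η x y (fun p => (η (curvesBetween (x p.1) (y p.2))).toReal) = η := by
  have := h.finite
  have h1 : redistribute η x y (fun p => (η (curvesBetween (x p.1) (y p.2))).toReal) =
      Measure.sum fun p : Idx M × Idx N => η.restrict (curvesBetween (x p.1) (y p.2)) := by
    rw [redistribute]
    congr 1
    ext1 p
    rw [ENNReal.ofReal_toReal (measure_ne_top _ _)]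
    rcases eq_or_ne (η (curvesBetween (x p.1) (y p.2))) 0 with h0 | h0
    · rw [Measure.restrict_eq_zero.2 h0, smul_zero]
    · rw [ENNReal.mul_inv_cancel h0 (measure_ne_top _ _), one_smul]
  rw [h1, ← Measure.restrict_iUnion (pairwise_disjoint_classes hx hy)
    fun p => measurableSet_class p]
  exact Measure.restrict_eq_self_of_ae_mem (hmem.mono fun γ hγ => mem_iUnion.2 hγ)

variable {h : IsGoodDecomposition η T} {hT : IsRectifiable T} {hx : Function.Injective x}
  {hy : Function.Injective y}

theorem weight_eq_zero (hw : w ∈ (h.weightedFamily hT hx hy).competitors) {p : Idx M × Idx N}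
    (h0 : η (curvesBetween (x p.1) (y p.2)) = 0) : w p = 0 :=
  (hw.1.1 p).2.2.2 (by simp [weightedFamily, h0])

theorem redistribute_class (hw : w ∈ (h.weightedFamily hT hx hy).competitors)
    (p : Idx M × Idx N) :
    redistribute η x y w (curvesBetween (x p.1) (y p.2)) = ENNReal.ofReal (w p) := by
  have := h.finite
  rw [← Measure.restrict_apply_univ, redistribute_restrict_class hx hy, Measure.smul_apply,
    Measure.restrict_apply_univ, smul_eq_mul]
  rcases eq_or_ne (η (curvesBetween (x p.1) (y p.2))) 0 with h0 | h0
  · simp [weight_eq_zero hw h0]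
  · rw [mul_assoc, ENNReal.inv_mul_cancel h0 (measure_ne_top _ _), mul_one]

theorem redistribute_univ (hw : w ∈ (h.weightedFamily hT hx hy).competitors) :
    redistribute η x y w univ = ∑' i, ENNReal.ofReal ((h.weightedFamily hT hx hy).row i) := by
  have h1 : ∀ p : Idx M × Idx N, ((ENNReal.ofReal (w p) *
      (η (curvesBetween (x p.1) (y p.2)))⁻¹) • η.restrict (curvesBetween (x p.1) (y p.2))) univ =
      ENNReal.ofReal (w p) := by
    intro p
    rw [← redistribute_restrict_class hx hy, Measure.restrict_apply_univ, redistribute_class hw]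
  rw [redistribute, Measure.sum_apply _ MeasurableSet.univ, tsum_congr h1, ENNReal.tsum_prod']
  exact tsum_congr fun i => WeightedFamily.tsum_ofReal_row hw.1 i

theorem redistribute_univ_eq (hw : w ∈ (h.weightedFamily hT hx hy).competitors)
    (hmem : ∀ᵐ γ ∂η, ∃ p : Idx M × Idx N, γ ∈ curvesBetween (x p.1) (y p.2)) :
    redistribute η x y w univ = η univ := by
  rw [redistribute_univ hw, ← redistribute_univ WeightedFamily.c_mem_competitors]
  exact congrArg (fun ν : Measure (LipCurve m) => ν univ) (h.redistribute_self hx hy hmem)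

theorem totalLength_redistribute_univ_le (hw : w ∈ (h.weightedFamily hT hx hy).competitors) :
    totalLength (redistribute η x y w) univ ≤ totalLength η univ := by
  rw [totalLength_redistribute MeasurableSet.univ]
  exact hw.1.2.2.2 univ MeasurableSet.univ

theorem integrable_redistribute (hw : w ∈ (h.weightedFamily hT hx hy).competitors) (ω : Form1 m) :
    Integrable (fun γ : LipCurve m => γ.current ω) (redistribute η x y w) := by
  have := h.isFiniteMeasure_totalLength
  refine ⟨(h.integrable ω).1.mono_ac redistribute_absolutelyContinuous, ?_⟩
  obtain ⟨C, hC⟩ := exists_norm_form1_le ω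
  calc ∫⁻ γ, ‖γ.current ω‖ₑ ∂redistribute η x y w
      ≤ ∫⁻ γ, C * γ.lengthMeasure univ ∂redistribute η x y w := by
        refine lintegral_mono_ae (redistribute_absolutelyContinuous.ae_le ?_)
        filter_upwards [h.supported] with γ hγ
        exact LipCurve.IsSimple.enorm_current_le hγ.2 hγ.1 hC
    _ = C * totalLength (redistribute η x y w) univ := by
        rw [lintegral_const_mul' _ _ ENNReal.coe_ne_top, totalLength_apply _ MeasurableSet.univ]
    _ ≤ C * totalLength η univ :=
        mul_le_mul' le_rfl (totalLength_redistribute_univ_le hw)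
    _ < ∞ := ENNReal.mul_lt_top ENNReal.coe_lt_top (measure_lt_top _ _)

theorem integral_redistribute (hw : w ∈ (h.weightedFamily hT hx hy).competitors) (ω : Form1 m) :
    ∫ γ, γ.current ω ∂redistribute η x y w =
      ∑' p : Idx M × Idx N, w p * normalizedCurrent η (x p.1) (y p.2) ω := by
  have := h.finite
  have hi := integrable_redistribute hw ω
  rw [redistribute] at hi ⊢
  rw [integral_sum_measure hi]
  refine tsum_congr fun p => ?_
  have h1 := congrFun (h.classCurrent_eq_smul (x p.1) (y p.2)) ω
  rw [classCurrent, Pi.smul_apply, smul_eq_mul] at h1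
  rw [integral_smul_measure, h1, ENNReal.toReal_mul, ENNReal.toReal_ofReal (hw.1.1 p).1,
    ENNReal.toReal_inv, smul_eq_mul]
  rcases eq_or_ne (η (curvesBetween (x p.1) (y p.2))) 0 with h0 | h0
  · simp [weight_eq_zero hw h0]
  · have h2 := (ENNReal.toReal_pos h0 (measure_ne_top _ _)).ne'
    rw [mul_assoc, inv_mul_cancel_left₀ h2]

/-- Redistributions by competitors of a good decomposition are good decompositions: the mass
identities follow from the inequalities `M(T) ≤ ∫ M(I_γ) ≤ ∫ ℋ¹(Im γ) ≤ M(T)`. -/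
theorem redistribute_good (hw : w ∈ (h.weightedFamily hT hx hy).competitors)
    (hmem : ∀ᵐ γ ∂η, ∃ p : Idx M × Idx N, γ ∈ curvesBetween (x p.1) (y p.2)) :
    IsGoodDecomposition (redistribute η x y w) T := by
  have := h.finite
  have hsupp : ∀ᵐ γ ∂redistribute η x y w, γ.IsNonconstant ∧ γ.IsSimple :=
    redistribute_absolutelyContinuous.ae_le h.supported
  have hrepr : ∀ ω : Form1 m, T ω = ∫ γ, γ.current ω ∂redistribute η x y w := by
    intro ω
    have h1 := integral_redistribute
      (WeightedFamily.c_mem_competitors (D := h.weightedFamily hT hx hy)) ω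
    have h2 : redistribute η x y (h.weightedFamily hT hx hy).c = η := h.redistribute_self hx hy hmem
    rw [h2] at h1
    rw [integral_redistribute hw, h.repr, h1]
    exact (hw.2 ω).symm
  -- Each of the three quantities is at most the next one, and the last at most the first.
  have hle₁ : mass (T : Form1 m → ℝ) ≤ ∫⁻ γ, mass γ.current ∂redistribute η x y w :=
    mass_le_lintegral_mass hrepr (integrable_redistribute hw)
  have hle₂ : ∫⁻ γ, mass γ.current ∂redistribute η x y w ≤
      ∫⁻ γ : LipCurve m, μH[1] (range (γ : ℝ≥0 → E m)) ∂redistribute η x y w := by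
    refine lintegral_mono_ae (hsupp.mono fun γ hγ => (hγ.2.mass_current_le hγ.1).trans_eq ?_)
    rw [← hγ.2.hausdorffMeasure_restrict_range hγ.1, Measure.restrict_apply_univ]
  have hle₃ : ∫⁻ γ : LipCurve m, μH[1] (range (γ : ℝ≥0 → E m)) ∂redistribute η x y w ≤
      mass (T : Form1 m → ℝ) := by
    rw [h.mass_eq_totalLength]
    refine le_trans (le_of_eq ?_) (totalLength_redistribute_univ_le hw)
    rw [totalLength_apply _ MeasurableSet.univ]
    refine lintegral_congr_ae (hsupp.mono fun γ hγ => ?_)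
    simp only
    rw [← hγ.2.hausdorffMeasure_restrict_range hγ.1, Measure.restrict_apply_univ]
  have hbd : ∫⁻ γ, mass (boundary γ.current) ∂redistribute η x y w = 2 * η univ := by
    rw [lintegral_congr_ae (hsupp.mono fun γ hγ => hγ.2.mass_boundary_current hγ.1),
      lintegral_const, redistribute_univ_eq hw hmem]
  exact
    { normal := h.normal
      finite := ⟨by rw [redistribute_univ_eq hw hmem]; exact measure_lt_top _ _⟩
      supported := hsupp
      integrable := integrable_redistribute hw
      repr := hrepr
      mass_eq := le_antisymm hle₁ (hle₂.trans hle₃)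
      mass_eq_length := le_antisymm hle₂ (hle₃.trans hle₁)
      mass_boundary_eq := by rw [hbd, h.mass_boundary_eq, h.mass_boundary_eq_two]
      mass_boundary_eq_two := by rw [hbd, redistribute_univ_eq hw hmem] }

/-- Redistribution does not change the normalized currents of the classes which keep a positive
weight. -/
theorem normalizedCurrent_redistribute (hw : w ∈ (h.weightedFamily hT hx hy).competitors)
    {p : Idx M × Idx N} (hp : 0 < w p) :
    normalizedCurrent (redistribute η x y w) (x p.1) (y p.2) =
      normalizedCurrent η (x p.1) (y p.2) := by
  have := h.finite
  have h0 : η (curvesBetween (x p.1) (y p.2)) ≠ 0 := fun h0 => hp.ne' (weight_eq_zero hw h0)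
  have h2 := (ENNReal.toReal_pos h0 (measure_ne_top _ _)).ne'
  rw [normalizedCurrent, redistribute_class hw, if_pos (ENNReal.ofReal_pos.2 hp),
    classCurrent_redistribute hx hy, h.classCurrent_eq_smul, smul_smul, smul_smul,
    ENNReal.toReal_mul, ENNReal.toReal_ofReal hp.le, ENNReal.toReal_inv,
    inv_mul_cancel_left₀ hp.ne',
    inv_mul_cancel₀ h2, one_smul]

end IsGoodDecomposition

end TransportPath

/-! ### Existence of better decompositions -/

theorem mainTheorem4 (m : ℕ) (M N : ℕ∞)
    (x : TransportPath.Idx M → TransportPath.E m) (y : TransportPath.Idx N → TransportPath.E m)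
    (hx : Function.Injective x) (hy : Function.Injective y)
    (a : TransportPath.Idx M → ℝ≥0) (b : TransportPath.Idx N → ℝ≥0)
    (hab : ∑' i, (a i : ℝ≥0∞) = ∑' j, (b j : ℝ≥0∞)) (hfin : ∑' i, (a i : ℝ≥0∞) < ∞)
    (T : TransportPath.Current1 m)
    (hT : TransportPath.IsTransportPath T
      (TransportPath.atomicMeasure a x) (TransportPath.atomicMeasure b y))
    (η : Measure (TransportPath.LipCurve m)) (hη : TransportPath.IsGoodDecomposition η T) :
    ∃ ηinf : Measure (TransportPath.LipCurve m),
      TransportPath.IsBetterDecomposition x y ηinf T ∧ TransportPath.Precc x y ηinf η := by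
  open TransportPath IsGoodDecomposition in
  have hmem := hη.ae_exists_mem_class hfin (hab ▸ hfin) hT
  -- Summable and strictly decreasing coefficients for the functional to be maximized.
  have hsum : ∀ K : ℕ∞, Summable fun i : Idx K => (1 / 2 : ℝ) ^ (i : ℕ) := fun K =>
    summable_geometric_two.comp_injective Subtype.val_injective
  have hanti : ∀ {K : ℕ∞} {i j : Idx K}, i < j → (1 / 2 : ℝ) ^ (j : ℕ) < (1 / 2 : ℝ) ^ (i : ℕ) :=
    fun hij => pow_lt_pow_right_of_lt_one₀ (by norm_num) (by norm_num) hij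
  obtain ⟨w, hw, hno⟩ := (hη.weightedFamily hT.1 hx hy).exists_competitor_forall_not_exchange
    (hsum M) (fun i => by positivity) (hsum N) (fun j => by positivity)
  have hgood := redistribute_good hw hmem
  refine ⟨redistribute η x y w, ⟨hgood, fun i₁ i₂ j₁ j₂ hi hj hrel => ?_⟩, fun i j =>
    ⟨_, ENNReal.toReal_nonneg, classCurrent_redistribute hx hy (i, j)⟩⟩
  rcases hgood.classes_pos_or_eq_zero (hx.ne hi.ne) (hy.ne hj.ne) hrel with hpos | hzero
  · exfalso
    have hwpos : ∀ p, 0 < redistribute η x y w (curvesBetween (x p.1) (y p.2)) → 0 < w p :=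
      fun p hp => ENNReal.ofReal_pos.1 (redistribute_class hw p ▸ hp)
    have p₁₁ := hwpos (i₁, j₁) hpos.1
    have p₁₂ := hwpos (i₁, j₂) hpos.2.1
    have p₂₁ := hwpos (i₂, j₁) hpos.2.2.1
    have p₂₂ := hwpos (i₂, j₂) hpos.2.2.2
    have hS : ∀ ω, normalizedCurrent η (x i₁) (y j₁) ω + normalizedCurrent η (x i₂) (y j₂) ω =
        normalizedCurrent η (x i₁) (y j₂) ω + normalizedCurrent η (x i₂) (y j₁) ω := by
      intro ω
      have h1 := congrFun hrel ω
      rw [normalizedCurrent_redistribute hw p₁₁, normalizedCurrent_redistribute hw p₁₂,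
        normalizedCurrent_redistribute hw p₂₁, normalizedCurrent_redistribute hw p₂₂] at h1
      simp only [Pi.add_apply, Pi.sub_apply, Pi.zero_apply] at h1
      linarith
    exact hno i₁ i₂ j₁ j₂ (hanti hi) (hanti hj) hS (hη.classLength_add_eq hS) ⟨p₁₁, p₁₂, p₂₁, p₂₂⟩
  · exact hzero
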